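/- Let $\lambda_0,\mu_0\in\mathbb R$ with $\mu_0>0$ and $\lambda_0+\mu_0>0$. Let $D\subset\mathbb R^2$ be a bounded domain whose boundary is a simple closed curve of class $\mathcal C^2$ with anticlockwise arclength parametrization $X:[a,b]\to\partial D$ (extended periodically to $\mathbb R$, so that $X\in\mathcal C^2(\mathbb R)$ and $|X'|=1$). At $x=X(s)$ let $\boldsymbol\tau(x)=X'(s)$, let $\mathbf n(x)=R_{-\pi/2}X'(s)$ be the outward unit normal, where $R_{-\pi/2}$ is the rotation by $-\pi/2$, and let $\partial/\partial\boldsymbol\tau=d/ds$. Put $$\mathbf\Gamma(x)=\frac{A}{2\pi}\log|x|\,\mathbf I-\frac{B}{2\pi}\frac{x\otimes x}{|x|^2}\quad(x\ne0),\qquad A=\frac12\Big(\frac1{\mu_0}+\frac1{2\mu_0+\lambda_0}\Big),\quad B=\frac12\Big(\frac1{\mu_0}-\frac1{2\mu_0+\lambda_0}\Big),$$ $$\boldsymbol{\mathcal D}^\sharp_D[\boldsymbol\phi](x)=\int_{\partial D}\frac{\partial\mathbf\Gamma(x-y)}{\partial\mathbf n(y)}\boldsymbol\phi(y)\,d\sigma(y),\qquad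 x\in\mathbb R^2\setminus\partial D .$$ For a differentiable vector field $\mathbf u$, a point $x\in\partial D$ and $x_t:=x+t\,\mathbf n(x)$ with $t\neq0$ small, let $$\frac{\partial\mathbf u}{\partial\nu}(x_t)=\lambda_0(\nabla\cdot\mathbf u)(x_t)\,\mathbf n(x)+\mu_0\big(\nabla\mathbf u+(\nabla\mathbf u)^T\big)(x_t)\,\mathbf n(x),\qquad \frac{\partial\mathbf u}{\partial\nu}\Big|_{\pm}(x)=\lim_{t\to0^{\pm}}\frac{\partial\mathbf u}{\partial\nu}(x_t).$$ Let $\boldsymbol\phi\in\mathcal C^{1,k}(\partial D)$ for some $0<k<1$, let $\mathbf u=\boldsymbol{\mathcal D}^\sharp_D[\boldsymbol\phi]$, and let $$\mathbf J=\frac{\partial}{\partial\boldsymbol\tau}\Big(\langle\boldsymbol\phi,\boldsymbol\tau\rangle\,\mathbf n+\frac{\lambda_0}{2\mu_0+\lambda_0}\langle\boldsymbol\phi,\mathbf n\rangle\,\boldsymbol\tau\Big)\quad\text{on }\partial D .$$ Then $\mathbf u$ is differentiable in $\mathbb R^2\setminus\partial D$, and the following hold. (i) At every $x\in\partial D$,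 $$\lim_{t\to0^+}\Big(\frac{\partial\mathbf u}{\partial\nu}(x_t)-\frac{\partial\mathbf u}{\partial\nu}(x_{-t})\Big)=\mathbf J(x).$$ (ii) At almost every $x\in\partial D$ with respect to arclength, both one-sided conormal derivatives exist, and $$\frac{\partial\boldsymbol{\mathcal D}^\sharp_D[\boldsymbol\phi]}{\partial\nu}\Big|_{+}(x)-\frac{\partial\boldsymbol{\mathcal D}^\sharp_D[\boldsymbol\phi]}{\partial\nu}\Big|_{-}(x)=\mathbf J(x).$$ (iii) If moreover $X''$ is Hölder continuous with some exponent $\alpha>0$, then both one-sided conormal derivatives exist and the identity in (ii) holds at every $x\in\partial D$. -/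

import Mathlib

open Set Filter Topology MeasureTheory
open scoped NNReal RealInnerProductSpace

noncomputable section

namespace Elastic

/-- The Euclidean plane. -/
abbrev Plane : Type := EuclideanSpace ℝ (Fin 2)

/-- Rotation of the plane by the angle `-π/2`. -/
def rotNeg (v : Plane) : Plane := !₂[v 1, - v 0]

/-- The unit tangent vector `τ` at the boundary point `X s`. -/
def tangent (X : ℝ → Plane) (s : ℝ) : Plane := deriv X s

/-- The unit normal vector `n` at the boundary point `X s`. -/
def normal (X : ℝ → Plane) (s : ℝ) : Plane := rotNeg (deriv X s)

/-- `D` is a bounded planar domain whose boundary is a simple closed curve of class `C²`;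
`X : [a, b] → ∂D`, extended periodically to the line, is its arclength parametrization in the
anticlockwise direction, that is, the one for which the rotated tangent `normal X` is the
outward normal of `D`. -/
structure IsC2Domain (D : Set Plane) (a b : ℝ) (X : ℝ → Plane) : Prop where
  lt : a < b
  contDiff : ContDiff ℝ 2 X
  periodic : Function.Periodic X (b - a)
  unit_speed : ∀ s, ‖deriv X s‖ = 1
  injOn : InjOn X (Ico a b)
  isOpen : IsOpen D
  isConnected : IsConnected D
  isBounded : Bornology.IsBounded D
  frontier_eq : frontier D = range X
  inward : ∀ s, ∀ᶠ t in 𝓝[>] (0 : ℝ), X s - t • normal X s ∈ D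
  outward : ∀ s, ∀ᶠ t in 𝓝[>] (0 : ℝ), X s + t • normal X s ∉ closure D

/-- `φ` is of class `C^{1,k}` on the curve parametrized by arclength by `X`
(only the values of `φ` on the curve matter). -/
def IsC1Holder (X : ℝ → Plane) (k : ℝ≥0) (φ : Plane → Plane) : Prop :=
  ContDiff ℝ 1 (φ ∘ X) ∧ ∃ C : ℝ≥0, HolderWith C k (deriv (φ ∘ X))

/-- The tensor product `u ⊗ v`, acting by `(u ⊗ v) w = ⟨v, w⟩ u`. -/
def tensor (u v : Plane) : Plane →L[ℝ] Plane := (innerSL ℝ v).smulRight u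

/-- The constant `A = (1/μ + 1/(2μ + λ)) / 2`. -/
def constA (lam mu : ℝ) : ℝ := 1 / 2 * (1 / mu + 1 / (2 * mu + lam))

/-- The constant `B = (1/μ - 1/(2μ + λ)) / 2`. -/
def constB (lam mu : ℝ) : ℝ := 1 / 2 * (1 / mu - 1 / (2 * mu + lam))

/-- The Kelvin matrix `Γ(x) = A/(2π) log|x| I - B/(2π) (x ⊗ x)/|x|²`, `x ≠ 0`. -/
def kelvin (lam mu : ℝ) (x : Plane) : Plane →L[ℝ] Plane :=
  (constA lam mu / (2 * Real.pi) * Real.log ‖x‖) • ContinuousLinearMap.id ℝ Plane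
    - (constB lam mu / (2 * Real.pi) / ‖x‖ ^ 2) • tensor x x

/-- The standard double layer potential
`D♯[φ](x) = ∫_{∂D} (∂Γ(x - y)/∂n(y)) φ(y) dσ(y)`. Since `X` has unit speed, `dσ(y) = ds` for
`y = X s`. -/
def doubleLayerSharp (lam mu a b : ℝ) (X : ℝ → Plane) (φ : Plane → Plane) (x : Plane) : Plane :=
  ∫ s in a..b, (lineDeriv ℝ (fun y => kelvin lam mu (x - y)) (X s) (normal X s)) (φ (X s))

/-- The divergence of a planar vector field. -/
def divergence (u : Plane → Plane) (x : Plane) : ℝ :=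
  ∑ i : Fin 2, fderiv ℝ u x (EuclideanSpace.single i 1) i

/-- The conormal derivative `λ (∇ · u) n + μ (∇u + (∇u)ᵀ) n` of `u` at `x` in the direction `n`. -/
def conormal (lam mu : ℝ) (u : Plane → Plane) (n x : Plane) : Plane :=
  (lam * divergence u x) • n
    + mu • (fderiv ℝ u x n + ContinuousLinearMap.adjoint (fderiv ℝ u x) n)

/-- The limit `w|₊ = lim_{t → 0⁺} w(x + t n)` exists and equals `l`. -/
def HasOuterTrace (w : Plane → Plane) (n x l : Plane) : Prop :=
  Tendsto (fun t : ℝ => w (x + t • n)) (𝓝[>] 0) (𝓝 l)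

/-- The limit `w|₋ = lim_{t → 0⁻} w(x + t n)` exists and equals `l`. -/
def HasInnerTrace (w : Plane → Plane) (n x l : Plane) : Prop :=
  Tendsto (fun t : ℝ => w (x + t • n)) (𝓝[<] 0) (𝓝 l)

/-- The tangential derivative `∂/∂τ (⟨φ, τ⟩ n + λ/(2μ + λ) ⟨φ, n⟩ τ)` at `X s`, that is, the
derivative with respect to arclength. -/
def jumpDensity (lam mu : ℝ) (X : ℝ → Plane) (φ : Plane → Plane) (s : ℝ) : Plane :=
  deriv (fun r => ⟪φ (X r), tangent X r⟫ • normal X r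
    + (lam / (2 * mu + lam) * ⟪φ (X r), normal X r⟫) • tangent X r) s

end Elastic

end

/-! Identify the plane with `ℂ`, and let `f`, `τ` and `-iτ` be the density, tangent and normal along
the curve. The double layer potential becomes an integral of `1/w`, `1/w̄` and `w/w̄²`, with `w = z
- Z(s)`. Its Wirtinger derivatives `∂_z`, `∂_z̄` have kernels of degree `-2`; integrating by parts
around the closed curve moves one derivative to the density, and `τ τ̄ = 1` makes everything fit.
What remains are layer potentials with the odd kernels `1/w`, `1/w̄`, `w/w̄²` of degree `-1` and the
densities `f'`, `f̄'` and `m = (f̄ τ²)'`. The conormal derivative is `2(λ+μ) Re(∂_z u) n + 2μ (∂_z̄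
u) n̄`, hence a combination of such potentials (`toComplex_conormal`, `integral_layerKernelDz`,
`integral_layerKernelDzbar`).

Jump. The difference of an odd kernel at distances `t` and `-t` from the curve is `O(t/(t+|σ|)²)`,
an approximate identity up to a constant factor. So for a density that is merely continuous the
symmetric difference converges, to the density at the foot point times an explicit integral over the
tangent line (`IsArc.tendsto_jump`). Summing the contributions, the `f̄' τ²` terms cancel and the
rest is `J` (`tendsto_tractionAlong_sub`, `toComplex_jumpDensity`).

One-sided limits. For a constant density, write the value as half the difference plus half the sum
of the values on the two sides; pairing `σ` with `-σ` and using oddness, the sum has a bounded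
integrand because the curve has second order contact with its tangent. A density that is Dini
continuous at the foot point adds only an absolutely convergent integral
(`IsArc.exists_tendsto_of_dini`). This handles `f'`, and also `m` when `X''` is Hölder continuous.

In general `m` contains `X''`, which is only continuous. It meets the kernel `1/w̄` only, and
replacing the curve by its tangent line leaves a Cauchy integral on the line, which converges almost
everywhere by Privalov's theorem (`ae_exists_tendsto_cauchy`). There the density is projected in
`L²` onto the nonpositive frequencies, which turns the Cauchy kernel into a Poisson kernel, and
Fatou's theorem applies. Once the outer limit exists, the jump relation gives the inner one. -/

namespace Elastic

open Complex
open scoped ComplexConjugate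

/-! ### Odd homogeneous kernels. -/

/-- Odd kernels on the punctured complex plane, homogeneous of degree `-1` and with the
regularity of such a kernel. -/
structure IsOddKernel (K : ℂ → ℂ) (C : ℝ) : Prop where
  smul : ∀ (t : ℝ) (w : ℂ), K (t * w) = (t : ℂ)⁻¹ * K w
  lip : ∀ a b : ℂ, a ≠ 0 → b ≠ 0 → ‖K a - K b‖ ≤ C * ‖a - b‖ / (‖a‖ * ‖b‖)

namespace IsOddKernel

variable {K : ℂ → ℂ} {C : ℝ}

lemma neg (hK : IsOddKernel K C) (w : ℂ) : K (-w) = -K w := by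
  have := hK.smul (-1) w
  simpa using this

lemma const_nonneg (hK : IsOddKernel K C) : 0 ≤ C := by
  have h := (norm_nonneg _).trans (hK.lip 1 (-1) (by simp) (by simp))
  have h2 : ‖(1 : ℂ) - -1‖ = 2 := by norm_num
  rw [h2] at h
  simp at h
  linarith

/-- Oddness turns the bound on differences into a bound on size: compare `a` with `-a`. -/
lemma norm_le (hK : IsOddKernel K C) {a : ℂ} (ha : a ≠ 0) : ‖K a‖ ≤ C / ‖a‖ := by
  have h := hK.lip a (-a) ha (neg_ne_zero.2 ha)
  rw [hK.neg, sub_neg_eq_add, sub_neg_eq_add, ← two_mul, ← two_mul, norm_mul, norm_mul,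
    norm_neg] at h
  have ha' : 0 < ‖a‖ := norm_pos_iff.2 ha
  have e : C * (‖(2 : ℂ)‖ * ‖a‖) / (‖a‖ * ‖a‖) = 2 * (C / ‖a‖) := by
    norm_num
    field_simp
  rw [e] at h
  norm_num at h
  linarith

lemma continuousAt (hK : IsOddKernel K C) {a : ℂ} (ha : a ≠ 0) : ContinuousAt K a := by
  have ha' : 0 < ‖a‖ := norm_pos_iff.2 ha
  rw [ContinuousAt, tendsto_iff_norm_sub_tendsto_zero]
  have h1 : Tendsto (fun b : ℂ => C * ‖b - a‖ / (‖b‖ * ‖a‖)) (𝓝 a) (𝓝 0) := by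
    have : ContinuousAt (fun b : ℂ => C * ‖b - a‖ / (‖b‖ * ‖a‖)) a := by
      apply ContinuousAt.div (by fun_prop) (by fun_prop)
      positivity
    have h := this.tendsto
    simpa using h
  refine squeeze_zero' (Eventually.of_forall fun _ => norm_nonneg _) ?_ h1
  filter_upwards [isOpen_ne.mem_nhds ha] with b hb using hK.lip b a hb ha

lemma measurable (hK : IsOddKernel K C) : Measurable K :=
  measurable_of_continuousOn_compl_singleton 0 fun _ ha => (hK.continuousAt ha).continuousWithinAt

end IsOddKernel

/-! ### Layer potentials on an arc, along the normal at its foot point. -/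

/-- A simple arc `γ : [-L, L] → ℂ` through the origin, with tangent `τ` there and second order
contact with its tangent line. -/
structure IsArc (L : ℝ) (τ : ℂ) (γ : ℝ → ℂ) : Prop where
  pos : 0 < L
  norm_tangent : ‖τ‖ = 1
  continuous : Continuous γ
  ne_zero : ∀ σ, σ ≠ 0 → |σ| ≤ L → γ σ ≠ 0
  contact : ∃ M : ℝ, 0 ≤ M ∧ ∀ σ, |σ| ≤ L → ‖γ σ - σ * τ‖ ≤ M * σ ^ 2

/-- Throughout, `-I * τ` is the tangent rotated by `-π/2`, that is, the unit normal. -/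
lemma norm_normal_sub_tangent_sq {τ : ℂ} (hτ : ‖τ‖ = 1) (t r : ℝ) :
    ‖t * (-I * τ) - r * τ‖ ^ 2 = t ^ 2 + r ^ 2 := by
  have : t * (-I * τ) - r * τ = (-(r : ℂ) + (-t : ℝ) * I) * τ := by push_cast; ring
  rw [this, norm_mul, hτ, mul_one, ← ofReal_neg, Complex.sq_norm, Complex.normSq_add_mul_I]
  ring

lemma abs_add_abs_le_norm_normal_sub_tangent {τ : ℂ} (hτ : ‖τ‖ = 1) (t r : ℝ) :
    (|t| + |r|) / 2 ≤ ‖t * (-I * τ) - r * τ‖ := by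
  rw [← pow_le_pow_iff_left₀ (by positivity) (norm_nonneg _) two_ne_zero]
  rw [norm_normal_sub_tangent_sq hτ]
  nlinarith [sq_abs t, sq_abs r, sq_nonneg (|t| - |r|)]

namespace IsArc

variable {L : ℝ} {τ : ℂ} {γ : ℝ → ℂ}

/-- Near the foot point the arc is a small perturbation of its tangent line, where Pythagoras gives
the bound; away from it, simplicity and compactness keep the arc at a positive distance from the
origin. All later dominated convergence arguments rest on this estimate. -/
lemma exists_lower_bound (h : IsArc L τ γ) : ∃ c t₀ : ℝ, 0 < c ∧ 0 < t₀ ∧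
    ∀ t σ : ℝ, |t| ≤ t₀ → |σ| ≤ L → c * (|t| + |σ|) ≤ ‖t * (-I * τ) - γ σ‖ := by
  obtain ⟨M, hM0, hM⟩ := h.contact
  have hL := h.pos
  -- For `|σ| ≤ δ` the contact error `M σ²` is at most `|σ|/4`, half of what the tangent line
  -- guarantees.
  set δ : ℝ := 1 / (4 * (M + 1)) with hδ
  have hδ0 : 0 < δ := by positivity
  have hMδ : M * δ ≤ 1 / 4 := by
    rw [hδ, mul_one_div, div_le_div_iff₀ (by positivity) (by norm_num)]
    linarith
  obtain ⟨η, hη0, hη⟩ : ∃ η : ℝ, 0 < η ∧ ∀ σ, δ ≤ |σ| → |σ| ≤ L → η ≤ ‖γ σ‖ := by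
    have hc : IsCompact {σ : ℝ | δ ≤ |σ| ∧ |σ| ≤ L} := by
      refine (isCompact_Icc (a := -L) (b := L)).of_isClosed_subset ?_ ?_
      · exact (isClosed_le continuous_const continuous_abs).inter
          (isClosed_le continuous_abs continuous_const)
      · rintro σ ⟨_, h2⟩
        exact abs_le.1 h2
    rcases Set.eq_empty_or_nonempty {σ : ℝ | δ ≤ |σ| ∧ |σ| ≤ L} with he | hne
    · refine ⟨1, one_pos, fun σ h1 h2 => ?_⟩
      have : σ ∈ {σ : ℝ | δ ≤ |σ| ∧ |σ| ≤ L} := ⟨h1, h2⟩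
      rw [he] at this
      exact this.elim
    · obtain ⟨σ₀, hσ₀, hmin⟩ := hc.exists_isMinOn hne (h.continuous.norm.continuousOn)
      refine ⟨‖γ σ₀‖, norm_pos_iff.2 (h.ne_zero σ₀ ?_ hσ₀.2), fun σ h1 h2 => hmin ⟨h1, h2⟩⟩
      rintro rfl
      have := hσ₀.1
      simp at this
      linarith
  -- `1/4` serves `|σ| ≤ δ`. For `|σ| ≥ δ` the distance is at least `η - |t| ≥ η/2`, while `|t| +
  -- |σ| ≤ η/2 + L`.
  refine ⟨min (1 / 4) (η / 2 / (η / 2 + L)), η / 2, by positivity, by positivity, ?_⟩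
  intro t σ ht hσ
  rcases le_total |σ| δ with hs | hs
  · have h1 := abs_add_abs_le_norm_normal_sub_tangent h.norm_tangent t σ
    have h2 : M * σ ^ 2 ≤ (|t| + |σ|) / 4 := by
      have : M * σ ^ 2 ≤ (1 / 4) * |σ| := by
        calc M * σ ^ 2 = M * |σ| * |σ| := by rw [← sq_abs]; ring
          _ ≤ M * δ * |σ| := by gcongr
          _ ≤ (1 / 4) * |σ| := by gcongr
      linarith [abs_nonneg t]
    have h3 : ‖t * (-I * τ) - σ * τ‖ ≤ ‖t * (-I * τ) - γ σ‖ + ‖γ σ - σ * τ‖ := by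
      refine le_trans (le_of_eq ?_) (norm_add_le _ _)
      congr 1
      ring
    have h4 := hM σ hσ
    calc _ ≤ (1 / 4) * (|t| + |σ|) := by gcongr; exact min_le_left _ _
      _ ≤ _ := by linarith
  · have h1 := hη σ hs hσ
    have h2 : ‖(t : ℂ) * (-I * τ)‖ = |t| := by simp [h.norm_tangent]
    have h3 : ‖γ σ‖ ≤ ‖t * (-I * τ) - γ σ‖ + ‖(t : ℂ) * (-I * τ)‖ := by
      rw [norm_sub_rev]
      refine le_trans (le_of_eq ?_) (norm_add_le _ _)
      congr 1
      ring
    calc _ ≤ (η / 2 / (η / 2 + L)) * (η / 2 + L) := by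
          gcongr
          exact min_le_right _ _
      _ = η / 2 := by field_simp
      _ ≤ _ := by linarith

lemma normal_sub_tangent_ne_zero {τ : ℂ} (hτ : ‖τ‖ = 1) {t : ℝ} (ht : t ≠ 0) (r : ℝ) :
    t * (-I * τ) - r * τ ≠ 0 := by
  have := abs_add_abs_le_norm_normal_sub_tangent hτ t r
  rw [← norm_pos_iff]
  have h := abs_pos.2 ht
  linarith [abs_nonneg r]

lemma tendsto_rescaled (h : IsArc L τ γ) (r : ℝ) :
    Tendsto (fun t : ℝ => (t : ℂ)⁻¹ * γ (t * r)) (𝓝[>] 0) (𝓝 (r * τ)) := by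
  obtain ⟨M, hM0, hM⟩ := h.contact
  rw [tendsto_iff_norm_sub_tendsto_zero]
  have h0 : Tendsto (fun t : ℝ => M * t * r ^ 2) (𝓝[>] 0) (𝓝 0) := by
    have : Continuous (fun t : ℝ => M * t * r ^ 2) := by fun_prop
    have := (this.tendsto 0).mono_left (nhdsWithin_le_nhds (s := Ioi 0))
    simpa using this
  have h1 : ∀ᶠ t : ℝ in 𝓝[>] 0, |t * r| ≤ L := by
    have : Continuous (fun t : ℝ => |t * r|) := by fun_prop
    have := (this.tendsto 0).mono_left (nhdsWithin_le_nhds (s := Ioi 0))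
    simp only [zero_mul, abs_zero] at this
    exact this.eventually_le_const h.pos
  refine squeeze_zero' (Eventually.of_forall fun _ => norm_nonneg _) ?_ h0
  filter_upwards [h1, self_mem_nhdsWithin] with t ht ht0
  have ht0 : 0 < t := ht0
  have htc : (t : ℂ) ≠ 0 := by exact_mod_cast ht0.ne'
  have e : (t : ℂ)⁻¹ * γ (t * r) - r * τ = (t : ℂ)⁻¹ * (γ (t * r) - (t * r : ℝ) * τ) := by
    push_cast
    field_simp
  rw [e, norm_mul, norm_inv, Complex.norm_real, Real.norm_eq_abs, abs_of_pos ht0]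
  calc t⁻¹ * ‖γ (t * r) - (t * r : ℝ) * τ‖ ≤ t⁻¹ * (M * (t * r) ^ 2) := by gcongr; exact hM _ ht
    _ = M * t * r ^ 2 := by field_simp

variable {K : ℂ → ℂ} {C : ℝ}

/-- By homogeneity `t K(t w) = K(w)`, so zooming in at scale `t` replaces the arc by its tangent
line. The parameter `e = ±1` selects the side. -/
lemma tendsto_kernel_rescaled (h : IsArc L τ γ) (hK : IsOddKernel K C) {e : ℝ} (he : e ≠ 0)
    (r : ℝ) : Tendsto (fun t : ℝ => t * K (t * (e * (-I * τ)) - γ (t * r))) (𝓝[>] 0)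
      (𝓝 (K (e * (-I * τ) - r * τ))) := by
  have h1 := (hK.continuousAt (normal_sub_tangent_ne_zero h.norm_tangent he r)).tendsto.comp
    ((h.tendsto_rescaled r).const_sub (e * (-I * τ)))
  refine h1.congr' ?_
  filter_upwards [self_mem_nhdsWithin] with t ht0
  have htc : (t : ℂ) ≠ 0 := by exact_mod_cast (ne_of_gt ht0 : t ≠ 0)
  have h2 := hK.smul t⁻¹ (t * (e * (-I * τ)) - γ (t * r))
  rw [ofReal_inv, inv_inv] at h2
  rw [Function.comp_apply, ← h2]
  congr 1
  field_simp

/-- The jump of a layer potential with an odd kernel: the difference of the values at two points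
symmetric with respect to the curve is an approximate identity. -/
lemma tendsto_jump (h : IsArc L τ γ) (hK : IsOddKernel K C) {g : ℝ → ℂ} (hg : Continuous g) :
    Tendsto (fun t : ℝ => ∫ σ in -L..L,
        g σ * (K (t * (-I * τ) - γ σ) - K ((-t : ℝ) * (-I * τ) - γ σ)))
      (𝓝[>] 0) (𝓝 (g 0 * ∫ r : ℝ, (K ((-I * τ) - r * τ) - K (-(-I * τ) - r * τ)))) := by
  obtain ⟨c, t₀, hc, ht₀, hlow⟩ := h.exists_lower_bound
  have hL := h.pos
  have hC := hK.const_nonneg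
  obtain ⟨G, hG⟩ : ∃ G : ℝ, ∀ σ ∈ Icc (-L) L, ‖g σ‖ ≤ G :=
    isCompact_Icc.exists_bound_of_continuousOn hg.continuousOn
  have hG0 : 0 ≤ G := (norm_nonneg _).trans (hG 0 ⟨by linarith, by linarith⟩)
  set f : ℝ → ℝ → ℂ := fun t σ =>
    g σ * (K (t * (-I * τ) - γ σ) - K ((-t : ℝ) * (-I * τ) - γ σ)) with hf
  have hfm : ∀ t, Measurable (f t) := fun t => by
    have hγ := h.continuous.measurable
    have := hK.measurable
    have := hg.measurable
    fun_prop
  -- The substitution `σ = t r`; the indicator extends the integral to the whole line, independently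
  -- of `t`.
  have key : Tendsto (fun t : ℝ => ∫ r : ℝ, (t : ℂ) * (Ioc (-L) L).indicator (f t) (t * r))
      (𝓝[>] 0) (𝓝 (∫ r : ℝ, g 0 * (K ((-I * τ) - r * τ) - K (-(-I * τ) - r * τ)))) := by
    refine tendsto_integral_filter_of_dominated_convergence
      (fun r => G * (2 * C / c ^ 2) * (1 + r ^ 2)⁻¹) ?_ ?_ ?_ ?_
    · refine Eventually.of_forall fun t => Measurable.aestronglyMeasurable ?_
      exact (((hfm t).indicator measurableSet_Ioc).comp (measurable_const_mul t)).const_mul _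
    · filter_upwards [Ioc_mem_nhdsGT ht₀] with t ht
      refine Eventually.of_forall fun r => ?_
      by_cases hr : t * r ∈ Ioc (-L) L
      · rw [indicator_of_mem hr]
        have hr' : |t * r| ≤ L := abs_le.2 ⟨hr.1.le, hr.2⟩
        have hta : |t| = t := abs_of_pos ht.1
        have l1 := hlow t (t * r) (hta.trans_le ht.2) hr'
        have l2 := hlow (-t) (t * r) (by rw [abs_neg]; exact hta.trans_le ht.2) hr'
        rw [abs_neg] at l2
        have e0 : c * (|t| + |t * r|) = c * t * (1 + |r|) := by
          rw [abs_mul, hta]; ring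
        rw [e0] at l1 l2
        have hp : 0 < c * t * (1 + |r|) := by have := ht.1; positivity
        have n1 := norm_pos_iff.1 (hp.trans_le l1)
        have n2 := norm_pos_iff.1 (hp.trans_le l2)
        have hl := hK.lip _ _ n1 n2
        have e1 : t * (-I * τ) - γ (t * r) - ((-t : ℝ) * (-I * τ) - γ (t * r))
          = (2 * t : ℝ) * (-I * τ) := by push_cast; ring
        have e2 : ‖((2 * t : ℝ) : ℂ) * (-I * τ)‖ = 2 * t := by
          rw [norm_mul, norm_mul, norm_neg, norm_I, h.norm_tangent, Complex.norm_real,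
            Real.norm_eq_abs, abs_of_pos (by linarith [ht.1])]
          ring
        rw [e1, e2] at hl
        have h0 : (0 : ℝ) < t := ht.1
        -- The two arguments differ by `2t` and both have size at least `c t (1 + |r|)`; after
        -- multiplication by `t` every power of `t` cancels.
        have hl2 : ‖K (t * (-I * τ) - γ (t * r)) - K ((-t : ℝ) * (-I * τ) - γ (t * r))‖
            ≤ C * (2 * t) / ((c * t * (1 + |r|)) * (c * t * (1 + |r|))) :=
          hl.trans (by gcongr)
        rw [hf, norm_mul, norm_mul, Complex.norm_real, Real.norm_eq_abs, hta]
        calc t * (‖g (t * r)‖ * _)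
            ≤ t * (G * (C * (2 * t) / ((c * t * (1 + |r|)) * (c * t * (1 + |r|))))) := by
              gcongr
              exact hG _ ⟨hr.1.le, hr.2⟩
          _ = G * (2 * C / c ^ 2) * ((1 + |r|) ^ 2)⁻¹ := by field_simp
          _ ≤ G * (2 * C / c ^ 2) * (1 + r ^ 2)⁻¹ := by
              gcongr
              nlinarith [abs_nonneg r, sq_abs r]
      · rw [indicator_of_notMem hr, mul_zero, norm_zero]
        positivity
    · exact integrable_inv_one_add_sq.const_mul _
    · refine Eventually.of_forall fun r => ?_
      have h1 := h.tendsto_kernel_rescaled hK one_ne_zero r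
      have h2 := h.tendsto_kernel_rescaled hK (neg_ne_zero.2 one_ne_zero) r
      have h0 : Tendsto (fun t : ℝ => t * r) (𝓝[>] 0) (𝓝 0) := by
        have : Continuous (fun t : ℝ => t * r) := by fun_prop
        have := (this.tendsto 0).mono_left (nhdsWithin_le_nhds (s := Ioi 0))
        simpa using this
      have h3 := (hg.tendsto 0).comp h0
      have h4 := h3.mul (h1.sub h2)
      simp only [ofReal_one, one_mul, ofReal_neg, neg_mul] at h4 ⊢
      refine h4.congr' ?_
      have h5 : ∀ᶠ t : ℝ in 𝓝[>] 0, t * r ∈ Ioc (-L) L :=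
        h0.eventually (Ioc_mem_nhds (by linarith) hL)
      filter_upwards [h5] with t ht
      rw [indicator_of_mem ht, hf]
      simp only [Function.comp_apply, ofReal_neg, neg_mul, mul_neg, neg_neg]
      ring
  rw [← integral_const_mul]
  refine key.congr' ?_
  filter_upwards [self_mem_nhdsWithin] with t ht
  have ht : 0 < t := ht
  have htc : (t : ℂ) ≠ 0 := by exact_mod_cast ht.ne'
  rw [integral_const_mul, Measure.integral_comp_mul_left, abs_of_pos (inv_pos.2 ht),
    integral_indicator measurableSet_Ioc, intervalIntegral.integral_of_le (by linarith),
    Complex.real_smul, ofReal_inv, mul_inv_cancel_left₀ htc]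

lemma intervalIntegrable_mul_kernel (h : IsArc L τ γ) (hK : IsOddKernel K C) {g : ℝ → ℂ}
    (hg : Continuous g) : ∀ᶠ t : ℝ in 𝓝[>] 0,
      IntervalIntegrable (fun σ => g σ * K (t * (-I * τ) - γ σ)) volume (-L) L ∧
      IntervalIntegrable (fun σ => g σ * K ((-t : ℝ) * (-I * τ) - γ σ)) volume (-L) L := by
  obtain ⟨c, t₀, hc, ht₀, hlow⟩ := h.exists_lower_bound
  have hγ := h.continuous
  have hL := h.pos
  have main : ∀ t : ℝ, t ≠ 0 → |t| ≤ t₀ →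
      IntervalIntegrable (fun σ => g σ * K (t * (-I * τ) - γ σ)) volume (-L) L := by
    intro t ht ht'
    apply ContinuousOn.intervalIntegrable
    refine hg.continuousOn.mul ?_
    intro σ hσ
    rw [uIcc_of_le (by linarith)] at hσ
    have hl := hlow t σ ht' (abs_le.2 hσ)
    have hp : 0 < c * (|t| + |σ|) := by have := abs_pos.2 ht; positivity
    have := (hK.continuousAt (norm_pos_iff.1 (hp.trans_le hl))).comp
      (f := fun σ => t * (-I * τ) - γ σ) (x := σ) (by fun_prop)
    exact this.continuousWithinAt
  filter_upwards [Ioc_mem_nhdsGT ht₀] with t ht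
  have hta : |t| = t := abs_of_pos ht.1
  exact ⟨main t ht.1.ne' (hta.trans_le ht.2),
    main (-t) (neg_ne_zero.2 ht.1.ne') (by rw [abs_neg]; exact hta.trans_le ht.2)⟩

lemma tendsto_kernel_normal (h : IsArc L τ γ) (hK : IsOddKernel K C) (e : ℝ) {σ : ℝ}
    (hσ : σ ≠ 0) (hσ' : |σ| ≤ L) :
    Tendsto (fun t : ℝ => K ((e * t : ℝ) * (-I * τ) - γ σ)) (𝓝[>] 0) (𝓝 (K (-γ σ))) := by
  have h1 : Continuous (fun t : ℝ => ((e * t : ℝ) : ℂ) * (-I * τ) - γ σ) := by fun_prop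
  have h2 := (h1.tendsto 0).mono_left (nhdsWithin_le_nhds (s := Ioi 0))
  simp only [mul_zero, ofReal_zero, zero_mul, zero_sub] at h2
  exact (hK.continuousAt (neg_ne_zero.2 (h.ne_zero σ hσ hσ'))).tendsto.comp h2

/-- The integral is half the difference plus half the sum of the values at `t` and `-t`. The
difference is the jump; the sum converges by the cancellation of `σ` against `-σ`. -/
lemma exists_tendsto_kernel (h : IsArc L τ γ) (hK : IsOddKernel K C) :
    ∃ l : ℂ, Tendsto (fun t : ℝ => ∫ σ in -L..L, K (t * (-I * τ) - γ σ)) (𝓝[>] 0) (𝓝 l) := by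
  obtain ⟨c, t₀, hc, ht₀, hlow⟩ := h.exists_lower_bound
  obtain ⟨M, hM0, hM⟩ := h.contact
  have hL := h.pos
  have hC := hK.const_nonneg
  have hJ := h.tendsto_jump hK (continuous_const (y := (1 : ℂ)))
  -- With `σ` reflected in the second term, oddness makes the integrand a difference of `K` at two
  -- points whose distance is at most `2 M σ²`: the linear parts cancel. The integrand is therefore
  -- bounded uniformly in `t`.
  have hS : Tendsto (fun t : ℝ => ∫ σ in -L..L,
      (K (t * (-I * τ) - γ σ) + K ((-t : ℝ) * (-I * τ) - γ (-σ)))) (𝓝[>] 0)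
      (𝓝 (∫ σ in -L..L, (K (-γ σ) + K (-γ (-σ))))) := by
    refine intervalIntegral.tendsto_integral_filter_of_dominated_convergence
      (fun _ => C * (2 * M) / c ^ 2) ?_ ?_ ?_ ?_
    · refine Eventually.of_forall fun t => Measurable.aestronglyMeasurable ?_
      have hγ := h.continuous.measurable
      have := hK.measurable
      fun_prop
    · filter_upwards [Ioc_mem_nhdsGT ht₀] with t ht
      refine Eventually.of_forall fun σ hσ => ?_
      rw [uIoc_of_le (by linarith)] at hσ
      have hσ' : |σ| ≤ L := abs_le.2 ⟨hσ.1.le, hσ.2⟩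
      have hta : |t| = t := abs_of_pos ht.1
      have l1 := hlow t σ (hta.trans_le ht.2) hσ'
      have l2 := hlow (-t) (-σ) (by rw [abs_neg]; exact hta.trans_le ht.2) (by rwa [abs_neg])
      rw [abs_neg, abs_neg] at l2
      have h0 := ht.1
      have hp : 0 < c * (|t| + |σ|) := by positivity
      have e1 : K ((-t : ℝ) * (-I * τ) - γ (-σ)) = - K (-((-t : ℝ) * (-I * τ) - γ (-σ))) := by
        rw [hK.neg, neg_neg]
      have hl := hK.lip (t * (-I * τ) - γ σ) (-((-t : ℝ) * (-I * τ) - γ (-σ)))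
        (norm_pos_iff.1 (hp.trans_le l1)) (neg_ne_zero.2 (norm_pos_iff.1 (hp.trans_le l2)))
      rw [norm_neg] at hl
      rw [e1, ← sub_eq_add_neg]
      have e2 : ‖t * (-I * τ) - γ σ - -((-t : ℝ) * (-I * τ) - γ (-σ))‖ ≤ 2 * M * σ ^ 2 := by
        have e3 : t * (-I * τ) - γ σ - -((-t : ℝ) * (-I * τ) - γ (-σ))
          = -(γ σ - σ * τ) - (γ (-σ) - (-σ : ℝ) * τ) := by push_cast; ring
        rw [e3]
        refine (norm_sub_le _ _).trans ?_
        rw [norm_neg]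
        have a1 := hM σ hσ'
        have a2 := hM (-σ) (by rwa [abs_neg])
        rw [neg_sq] at a2
        linarith
      calc _ ≤ _ := hl
        _ ≤ C * (2 * M * σ ^ 2) / ((c * (|t| + |σ|)) * (c * (|t| + |σ|))) := by gcongr
        _ ≤ C * (2 * M) / c ^ 2 := by
          rw [div_le_div_iff₀ (by positivity) (by positivity)]
          have : σ ^ 2 ≤ (|t| + |σ|) ^ 2 := by
            nlinarith [abs_nonneg t, abs_nonneg σ, sq_abs σ]
          calc C * (2 * M * σ ^ 2) * c ^ 2 ≤ C * (2 * M * (|t| + |σ|) ^ 2) * c ^ 2 := by gcongr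
            _ = _ := by ring
    · exact intervalIntegrable_const
    · have : ∀ᵐ σ : ℝ, σ ≠ 0 := by simp [ae_iff, measure_singleton]
      filter_upwards [this] with σ hσ hσ'
      rw [uIoc_of_le (by linarith)] at hσ'
      have hσ' : |σ| ≤ L := abs_le.2 ⟨hσ'.1.le, hσ'.2⟩
      have h1 := h.tendsto_kernel_normal hK 1 hσ hσ'
      have h2 := h.tendsto_kernel_normal hK (-1) (neg_ne_zero.2 hσ) (by rwa [abs_neg])
      simp only [one_mul, neg_mul] at h1 h2 ⊢
      exact h1.add h2
  refine ⟨_, ((hJ.add hS).const_mul (1 / 2 : ℂ)).congr' ?_⟩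
  filter_upwards [h.intervalIntegrable_mul_kernel hK (continuous_const (y := (1 : ℂ)))] with t ht
  simp only [one_mul] at ht ⊢
  have h3 : IntervalIntegrable (fun σ => K ((-t : ℝ) * (-I * τ) - γ (-σ))) volume (-L) L := by
    have := ht.2.symm.comp_mul_left (c := -1)
    simpa [div_neg] using this
  have h4 : ∫ σ in -L..L, K ((-t : ℝ) * (-I * τ) - γ (-σ))
      = ∫ σ in -L..L, K ((-t : ℝ) * (-I * τ) - γ σ) := by
    rw [intervalIntegral.integral_comp_neg (fun σ => K ((-t : ℝ) * (-I * τ) - γ σ)), neg_neg]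
  rw [intervalIntegral.integral_sub ht.1 ht.2, intervalIntegral.integral_add ht.1 h3, h4]
  ring

/-- One-sided limits exist for densities that are Dini continuous at the foot point. -/
lemma exists_tendsto_of_dini (h : IsArc L τ γ) (hK : IsOddKernel K C) {g : ℝ → ℂ}
    (hg : Continuous g)
    (hd : IntervalIntegrable (fun σ => |σ|⁻¹ * ‖g σ - g 0‖) volume (-L) L) :
    ∃ l : ℂ, Tendsto (fun t : ℝ => ∫ σ in -L..L, g σ * K (t * (-I * τ) - γ σ))
      (𝓝[>] 0) (𝓝 l) := by
  obtain ⟨c, t₀, hc, ht₀, hlow⟩ := h.exists_lower_bound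
  have hL := h.pos
  have hC := hK.const_nonneg
  obtain ⟨l, hl⟩ := h.exists_tendsto_kernel hK
  -- Since `|K| ≤ C / (c |σ|)` uniformly in `t`, the Dini quotient is an integrable majorant.
  have hA : Tendsto (fun t : ℝ => ∫ σ in -L..L, (g σ - g 0) * K (t * (-I * τ) - γ σ)) (𝓝[>] 0)
      (𝓝 (∫ σ in -L..L, (g σ - g 0) * K (-γ σ))) := by
    refine intervalIntegral.tendsto_integral_filter_of_dominated_convergence
      (fun σ => (C / c) * (|σ|⁻¹ * ‖g σ - g 0‖)) ?_ ?_ (hd.const_mul _) ?_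
    · refine Eventually.of_forall fun t => Measurable.aestronglyMeasurable ?_
      have hγ := h.continuous.measurable
      have := hK.measurable
      have := hg.measurable
      fun_prop
    · have : ∀ᵐ σ : ℝ, σ ≠ 0 := by simp [ae_iff, measure_singleton]
      filter_upwards [Ioc_mem_nhdsGT ht₀] with t ht
      filter_upwards [this] with σ hσ0 hσ
      rw [uIoc_of_le (by linarith)] at hσ
      have hσ' : |σ| ≤ L := abs_le.2 ⟨hσ.1.le, hσ.2⟩
      have hta : |t| = t := abs_of_pos ht.1
      have l1 := hlow t σ (hta.trans_le ht.2) hσ'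
      have h0 := ht.1
      have hσp := abs_pos.2 hσ0
      have hp : 0 < c * |σ| := by positivity
      have l2 : c * |σ| ≤ ‖t * (-I * τ) - γ σ‖ := by
        refine le_trans ?_ l1
        gcongr
        linarith [abs_nonneg t]
      have l3 := hK.norm_le (norm_pos_iff.1 (hp.trans_le l2))
      rw [norm_mul]
      calc ‖g σ - g 0‖ * ‖K (t * (-I * τ) - γ σ)‖ ≤ ‖g σ - g 0‖ * (C / (c * |σ|)) := by
            gcongr
            exact l3.trans (by gcongr)
        _ = _ := by field_simp
    · have : ∀ᵐ σ : ℝ, σ ≠ 0 := by simp [ae_iff, measure_singleton]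
      filter_upwards [this] with σ hσ hσ'
      rw [uIoc_of_le (by linarith)] at hσ'
      have h1 := h.tendsto_kernel_normal hK 1 hσ (abs_le.2 ⟨hσ'.1.le, hσ'.2⟩)
      simp only [one_mul] at h1
      exact h1.const_mul _
  refine ⟨_, (hA.add (hl.const_mul (g 0))).congr' ?_⟩
  filter_upwards [h.intervalIntegrable_mul_kernel hK hg,
    h.intervalIntegrable_mul_kernel hK (continuous_const (y := g 0))] with t h1 h2
  rw [← intervalIntegral.integral_const_mul]
  simp only [sub_mul]
  rw [intervalIntegral.integral_sub h1.1 h2.1, sub_add_cancel]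

lemma straight {L : ℝ} (hL : 0 < L) {τ : ℂ} (hτ : ‖τ‖ = 1) : IsArc L τ fun σ => σ * τ where
  pos := hL
  norm_tangent := hτ
  continuous := by fun_prop
  ne_zero σ hσ _ := by
    have : τ ≠ 0 := by rw [← norm_pos_iff, hτ]; exact one_pos
    simp [hσ, this]
  contact := ⟨0, le_rfl, fun σ _ => by simp⟩

/-- For the existence of one-sided limits, an arc may be replaced by its tangent line. -/
lemma exists_tendsto_of_straight (h : IsArc L τ γ) (hK : IsOddKernel K C) {g : ℝ → ℂ}
    (hg : Continuous g)
    (hs : ∃ l : ℂ, Tendsto (fun t : ℝ => ∫ σ in -L..L, g σ * K (t * (-I * τ) - σ * τ))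
      (𝓝[>] 0) (𝓝 l)) :
    ∃ l : ℂ, Tendsto (fun t : ℝ => ∫ σ in -L..L, g σ * K (t * (-I * τ) - γ σ))
      (𝓝[>] 0) (𝓝 l) := by
  obtain ⟨c, t₀, hc, ht₀, hlow⟩ := h.exists_lower_bound
  obtain ⟨M, hM0, hM⟩ := h.contact
  have hL := h.pos
  have hC := hK.const_nonneg
  have h' := straight hL h.norm_tangent
  obtain ⟨l, hl⟩ := hs
  obtain ⟨G, hG⟩ : ∃ G : ℝ, ∀ σ ∈ Icc (-L) L, ‖g σ‖ ≤ G :=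
    isCompact_Icc.exists_bound_of_continuousOn hg.continuousOn
  have hG0 : 0 ≤ G := (norm_nonneg _).trans (hG 0 ⟨by linarith, by linarith⟩)
  -- The arguments of the two kernels differ by at most `M σ²` and both are at least a multiple of
  -- `|σ|`, so the difference of the kernels is bounded.
  have hA : Tendsto (fun t : ℝ => ∫ σ in -L..L,
      g σ * (K (t * (-I * τ) - γ σ) - K (t * (-I * τ) - σ * τ))) (𝓝[>] 0)
      (𝓝 (∫ σ in -L..L, g σ * (K (-γ σ) - K (-(σ * τ))))) := by
    have hne : ∀ᵐ σ : ℝ, σ ≠ 0 := by simp [ae_iff, measure_singleton]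
    refine intervalIntegral.tendsto_integral_filter_of_dominated_convergence
      (fun σ => G * (2 * C * M / c)) ?_ ?_ intervalIntegrable_const ?_
    · refine Eventually.of_forall fun t => Measurable.aestronglyMeasurable ?_
      have hγ := h.continuous.measurable
      have := hK.measurable
      have := hg.measurable
      fun_prop
    · filter_upwards [Ioc_mem_nhdsGT ht₀] with t ht
      filter_upwards [hne] with σ hσ0 hσ
      rw [uIoc_of_le (by linarith)] at hσ
      have hσ' : |σ| ≤ L := abs_le.2 ⟨hσ.1.le, hσ.2⟩
      have hta : |t| = t := abs_of_pos ht.1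
      have hσp := abs_pos.2 hσ0
      have l1 : c * |σ| ≤ ‖t * (-I * τ) - γ σ‖ := by
        refine le_trans ?_ (hlow t σ (hta.trans_le ht.2) hσ')
        gcongr
        linarith [abs_nonneg t]
      have l2 : |σ| / 2 ≤ ‖t * (-I * τ) - σ * τ‖ := by
        refine le_trans ?_ (abs_add_abs_le_norm_normal_sub_tangent h.norm_tangent t σ)
        gcongr
        linarith [abs_nonneg t]
      have hp1 : 0 < c * |σ| := by positivity
      have hp2 : 0 < |σ| / 2 := by positivity
      have l3 := hK.lip _ _ (norm_pos_iff.1 (hp1.trans_le l1)) (norm_pos_iff.1 (hp2.trans_le l2))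
      have e : t * (-I * τ) - γ σ - (t * (-I * τ) - σ * τ) = -(γ σ - σ * τ) := by ring
      rw [e, norm_neg] at l3
      rw [norm_mul]
      gcongr
      · exact hG _ ⟨hσ.1.le, hσ.2⟩
      calc _ ≤ _ := l3
        _ ≤ C * (M * σ ^ 2) / ((c * |σ|) * (|σ| / 2)) := by
            gcongr
            exact hM σ hσ'
        _ = 2 * C * M / c := by
            rw [← sq_abs σ]
            field_simp
    · filter_upwards [hne] with σ hσ hσ'
      rw [uIoc_of_le (by linarith)] at hσ'
      have h1 := h.tendsto_kernel_normal hK 1 hσ (abs_le.2 ⟨hσ'.1.le, hσ'.2⟩)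
      have h2 := h'.tendsto_kernel_normal hK 1 hσ (abs_le.2 ⟨hσ'.1.le, hσ'.2⟩)
      simp only [one_mul] at h1 h2
      exact (h1.sub h2).const_mul _
  refine ⟨_, (hA.add hl).congr' ?_⟩
  filter_upwards [h.intervalIntegrable_mul_kernel hK hg,
    h'.intervalIntegrable_mul_kernel hK hg] with t h1 h2
  simp only [mul_sub]
  rw [intervalIntegral.integral_sub h1.1 h2.1, sub_add_cancel]

end IsArc

/-! ### Fatou's theorem for Poisson integrals. -/

/-- The Poisson integral of a function in the half plane converges vertically at every point where
the function is the derivative of its integral. -/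
lemma exists_tendsto_poisson_of_hasDerivAt {L : ℝ} (hL : 0 < L) {k : ℝ → ℝ}
    (hk : IntervalIntegrable k volume (-L) L) {d : ℝ}
    (hd : HasDerivAt (fun σ => ∫ u in (0 : ℝ)..σ, k u) d 0) :
    ∃ l : ℝ, Tendsto (fun t : ℝ => ∫ σ in -L..L, k σ * (t / (σ ^ 2 + t ^ 2)))
      (𝓝[>] 0) (𝓝 l) := by
  set P : ℝ → ℝ := fun σ => ∫ u in (0 : ℝ)..σ, k u with hP
  have h0 : (0 : ℝ) ∈ uIcc (-L) L := by
    rw [uIcc_of_le (by linarith)]; constructor <;> linarith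
  have hPac : AbsolutelyContinuousOnInterval P (-L) L :=
    hk.absolutelyContinuousOnInterval_intervalIntegral h0
  have hPd : ∀ᵐ σ : ℝ, σ ∈ uIcc (-L) L → deriv P σ = k σ := by
    filter_upwards [hk.ae_hasDerivAt_integral] with σ hσ hσ'
    exact (hσ hσ' 0 h0).deriv
  have hP0 : P 0 = 0 := by simp [hP]
  have hPc : ContinuousOn P (Icc (-L) L) := by
    have := hPac.continuousOn
    rwa [uIcc_of_le (by linarith)] at this
  -- Differentiability of `P` at `0` enters only here: it makes the quotient `P(σ)/σ` continuous
  -- across `0`.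
  have hQc : ContinuousOn (dslope P 0) (Icc (-L) L) := by
    rw [continuousOn_dslope (Icc_mem_nhds (by linarith) hL)]
    exact ⟨hPc, hd.differentiableAt⟩
  obtain ⟨M, hM⟩ : ∃ M : ℝ, ∀ σ ∈ Icc (-L) L, ‖dslope P 0 σ‖ ≤ M :=
    isCompact_Icc.exists_bound_of_continuousOn hQc
  have hM0 : 0 ≤ M := (norm_nonneg _).trans (hM 0 ⟨by linarith, by linarith⟩)
  have hPQ : ∀ σ, P σ = σ * dslope P 0 σ := fun σ => by
    have := sub_smul_dslope P 0 σ
    rw [hP0] at this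
    simpa using this.symm
  -- Integration by parts exchanges the merely integrable `k` for the continuous quotient `P(σ)/σ`,
  -- against a nonnegative kernel that is again homogeneous of degree `-1` in `(σ, t)`.
  have hparts : ∀ t : ℝ, 0 < t → ∫ σ in -L..L, k σ * (t / (σ ^ 2 + t ^ 2))
      = t / (L ^ 2 + t ^ 2) * (P L - P (-L))
        + ∫ σ in -L..L, 2 * t * σ ^ 2 / (σ ^ 2 + t ^ 2) ^ 2 * dslope P 0 σ := by
    intro t ht
    have hfd : ∀ σ : ℝ, HasDerivAt (fun σ => t / (σ ^ 2 + t ^ 2))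
        (-(2 * t * σ / (σ ^ 2 + t ^ 2) ^ 2)) σ := fun σ => by
      have h1 : HasDerivAt (fun σ : ℝ => σ ^ 2 + t ^ 2) (2 * σ) σ := by
        simpa using (hasDerivAt_pow 2 σ).add_const (t ^ 2)
      have hne : σ ^ 2 + t ^ 2 ≠ 0 := by positivity
      refine ((hasDerivAt_const σ t).div h1 hne).congr_deriv ?_
      ring
    have hfac : AbsolutelyContinuousOnInterval (fun σ => t / (σ ^ 2 + t ^ 2)) (-L) L := by
      have hderiv : deriv (fun σ => t / (σ ^ 2 + t ^ 2))
          = fun σ => -(2 * t * σ / (σ ^ 2 + t ^ 2) ^ 2) := funext fun σ => (hfd σ).deriv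
      have hcont : Continuous fun σ : ℝ => -(2 * t * σ / (σ ^ 2 + t ^ 2) ^ 2) := by
        refine Continuous.neg (Continuous.div (by fun_prop) (by fun_prop) fun σ => ?_)
        positivity
      have h1 := (hcont.intervalIntegrable (-L) L).absolutelyContinuousOnInterval_intervalIntegral h0
      have h2 : (fun σ => t / (σ ^ 2 + t ^ 2)) = fun σ =>
          (∫ u in (0 : ℝ)..σ, -(2 * t * u / (u ^ 2 + t ^ 2) ^ 2))
            - (-(t / ((0 : ℝ) ^ 2 + t ^ 2))) := by
        funext σ
        rw [intervalIntegral.integral_eq_sub_of_hasDerivAt (fun σ _ => hfd σ)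
          (hcont.intervalIntegrable _ _)]
        ring
      rw [h2]
      refine h1.fun_sub ?_
      exact (LipschitzWith.const _).lipschitzOnWith.absolutelyContinuousOnInterval
    have h1 := hfac.integral_mul_deriv_eq_deriv_mul hPac
    have h2 : ∫ σ in -L..L, k σ * (t / (σ ^ 2 + t ^ 2))
        = ∫ σ in -L..L, (t / (σ ^ 2 + t ^ 2)) * deriv P σ := by
      apply intervalIntegral.integral_congr_ae
      filter_upwards [hPd] with σ hσ hσ'
      rw [hσ (uIoc_subset_uIcc hσ'), mul_comm]
    rw [h2, h1, neg_sq, ← mul_sub, sub_eq_add_neg, ← intervalIntegral.integral_neg]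
    congr 1
    apply intervalIntegral.integral_congr
    intro σ _
    simp only
    rw [(hfd σ).deriv, hPQ]
    ring
  have hb : Tendsto (fun t : ℝ => t / (L ^ 2 + t ^ 2) * (P L - P (-L))) (𝓝[>] 0)
      (𝓝 0) := by
    have : ContinuousAt (fun t : ℝ => t / (L ^ 2 + t ^ 2) * (P L - P (-L))) 0 := by
      refine ContinuousAt.mul (ContinuousAt.div (by fun_prop) (by fun_prop) ?_) (by fun_prop)
      positivity
    have := this.tendsto.mono_left (nhdsWithin_le_nhds (s := Ioi 0))
    simpa using this
  -- Again `σ = t r`, with majorant `2 M / (1 + r²)`.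
  have key : Tendsto (fun t : ℝ => ∫ r : ℝ, t * (Ioc (-L) L).indicator
      (fun σ => 2 * t * σ ^ 2 / (σ ^ 2 + t ^ 2) ^ 2 * dslope P 0 σ) (t * r))
      (𝓝[>] 0) (𝓝 (∫ r : ℝ, 2 * r ^ 2 / (r ^ 2 + 1) ^ 2 * dslope P 0 0)) := by
    refine tendsto_integral_filter_of_dominated_convergence
      (fun r => 2 * M * (1 + r ^ 2)⁻¹) ?_ ?_ ?_ ?_
    · filter_upwards [self_mem_nhdsWithin] with t ht
      have ht : 0 < t := ht
      have hpw : (Ioc (-L) L).indicator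
          (fun σ => 2 * t * σ ^ 2 / (σ ^ 2 + t ^ 2) ^ 2 * dslope P 0 σ)
          = (Ioc (-L) L).piecewise
            (fun σ => 2 * t * σ ^ 2 / (σ ^ 2 + t ^ 2) ^ 2 * dslope P 0 σ) 0 := by
        rw [piecewise_eq_indicator]
      have hm : Measurable ((Ioc (-L) L).indicator
          (fun σ => 2 * t * σ ^ 2 / (σ ^ 2 + t ^ 2) ^ 2 * dslope P 0 σ)) := by
        rw [hpw]
        refine ContinuousOn.measurable_piecewise ?_ continuousOn_const measurableSet_Ioc
        refine ContinuousOn.mul (Continuous.continuousOn ?_) (hQc.mono Ioc_subset_Icc_self)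
        exact Continuous.div (by fun_prop) (by fun_prop) fun σ => by positivity
      exact ((hm.comp (measurable_const_mul t)).const_mul t).aestronglyMeasurable
    · filter_upwards [self_mem_nhdsWithin] with t ht
      have ht : 0 < t := ht
      refine Eventually.of_forall fun r => ?_
      by_cases hr : t * r ∈ Ioc (-L) L
      · rw [indicator_of_mem hr, norm_mul, norm_mul, Real.norm_eq_abs, Real.norm_eq_abs,
          abs_of_pos ht, abs_of_nonneg (by positivity)]
        calc t * (2 * t * (t * r) ^ 2 / ((t * r) ^ 2 + t ^ 2) ^ 2 * ‖dslope P 0 (t * r)‖)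
            ≤ t * (2 * t * (t * r) ^ 2 / ((t * r) ^ 2 + t ^ 2) ^ 2 * M) := by
              gcongr
              exact hM _ ⟨hr.1.le, hr.2⟩
          _ = 2 * M * (r ^ 2 / (1 + r ^ 2) * (1 + r ^ 2)⁻¹) := by
              have : (t * r) ^ 2 + t ^ 2 = t ^ 2 * (1 + r ^ 2) := by ring
              rw [this]
              field_simp
          _ ≤ 2 * M * (1 * (1 + r ^ 2)⁻¹) := by
              gcongr
              rw [div_le_one (by positivity)]
              linarith
          _ = _ := by ring
      · rw [indicator_of_notMem hr, mul_zero, norm_zero]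
        positivity
    · exact integrable_inv_one_add_sq.const_mul _
    · refine Eventually.of_forall fun r => ?_
      have h0 : Tendsto (fun t : ℝ => t * r) (𝓝[>] 0) (𝓝 0) := by
        have : Continuous (fun t : ℝ => t * r) := by fun_prop
        have := (this.tendsto 0).mono_left (nhdsWithin_le_nhds (s := Ioi 0))
        simpa using this
      have h1 : ContinuousAt (dslope P 0) 0 := hQc.continuousAt (Icc_mem_nhds (by linarith) hL)
      have h2 := (h1.tendsto.comp h0).const_mul (2 * r ^ 2 / (r ^ 2 + 1) ^ 2)
      refine h2.congr' ?_
      have h5 : ∀ᶠ t : ℝ in 𝓝[>] 0, t * r ∈ Ioc (-L) L :=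
        h0.eventually (Ioc_mem_nhds (by linarith) hL)
      filter_upwards [h5, self_mem_nhdsWithin] with t ht ht0
      have ht0 : 0 < t := ht0
      rw [indicator_of_mem ht, Function.comp_apply]
      have : (t * r) ^ 2 + t ^ 2 = t ^ 2 * (r ^ 2 + 1) := by ring
      rw [this]
      field_simp
  refine ⟨_, (hb.add key).congr' ?_⟩
  filter_upwards [self_mem_nhdsWithin] with t ht
  have ht : 0 < t := ht
  rw [hparts t ht, integral_const_mul, Measure.integral_comp_mul_left, abs_of_pos (inv_pos.2 ht),
    integral_indicator measurableSet_Ioc, intervalIntegral.integral_of_le (by linarith),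
    smul_eq_mul, mul_inv_cancel_left₀ ht.ne']

/-- **Fatou's theorem** for Poisson integrals on the line, vertical convergence. -/
lemma ae_exists_tendsto_poisson {L : ℝ} (hL : 0 < L) {h : ℝ → ℂ}
    (hh : LocallyIntegrable h volume) :
    ∀ᵐ x : ℝ, ∃ l : ℂ, Tendsto
      (fun t : ℝ => ∫ σ in -L..L, h (x + σ) * ((t / (σ ^ 2 + t ^ 2) : ℝ) : ℂ)) (𝓝[>] 0) (𝓝 l) := by
  filter_upwards [LocallyIntegrable.ae_hasDerivAt_integral hh] with x hx
  have hI : ∀ a b : ℝ, IntervalIntegrable (fun σ => h (x + σ)) volume a b := fun a b => by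
    have h1 : IntervalIntegrable h volume (x + a) (x + b) :=
      intervalIntegrable_iff.mpr <|
        (hh.integrableOn_isCompact isCompact_uIcc).mono_set uIoc_subset_uIcc
    have := h1.comp_add_left x
    simpa using this
  have hd : HasDerivAt (fun σ => ∫ u in (0 : ℝ)..σ, h (x + u)) (h x) 0 := by
    have h1 : (fun σ : ℝ => ∫ u in (0 : ℝ)..σ, h (x + u))
        = fun σ => ∫ u in x..(x + σ), h u := by
      funext σ
      rw [intervalIntegral.integral_comp_add_left (fun u => h u), add_zero]
    rw [h1]
    have h2 := hx x
    rw [← add_zero x] at h2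
    exact HasDerivAt.comp_const_add x 0 (by simpa using h2)
  -- Applied to the real and imaginary parts, as the preceding lemma concerns real densities.
  have hkey : ∀ c : ℂ →L[ℝ] ℝ, ∃ l : ℝ, Tendsto
      (fun t : ℝ => ∫ σ in -L..L, c (h (x + σ)) * (t / (σ ^ 2 + t ^ 2))) (𝓝[>] 0) (𝓝 l) := by
    intro c
    have hc : IntervalIntegrable (fun σ => c (h (x + σ))) volume (-L) L :=
      ⟨c.integrable_comp (hI _ _).1, c.integrable_comp (hI _ _).2⟩
    refine exists_tendsto_poisson_of_hasDerivAt hL hc (d := c (h x)) ?_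
    have h1 := c.hasFDerivAt.comp_hasDerivAt (0 : ℝ) hd
    refine h1.congr_of_eventuallyEq (Eventually.of_forall fun σ => ?_)
    simp only [Function.comp_apply]
    rw [c.intervalIntegral_comp_comm (hI _ _)]
  obtain ⟨l₁, hl₁⟩ := hkey reCLM
  obtain ⟨l₂, hl₂⟩ := hkey imCLM
  refine ⟨l₁ + l₂ * I, Tendsto.congr' ?_
    (((continuous_ofReal.tendsto l₁).comp hl₁).add
      (((continuous_ofReal.tendsto l₂).comp hl₂).mul_const I))⟩
  filter_upwards [self_mem_nhdsWithin] with t ht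
  have ht : 0 < t := ht
  have hP : ContinuousOn (fun σ : ℝ => t / (σ ^ 2 + t ^ 2)) (uIcc (-L) L) :=
    (Continuous.div (by fun_prop) (by fun_prop) fun σ => by positivity).continuousOn
  have hPI := (hI (-L) L).mul_continuousOn (continuous_ofReal.comp_continuousOn hP)
  simp only [Function.comp_apply] at hPI ⊢
  have e1 := reCLM.intervalIntegral_comp_comm hPI
  have e2 := imCLM.intervalIntegral_comp_comm hPI
  simp only [reCLM_apply, imCLM_apply, re_mul_ofReal, im_mul_ofReal] at e1 e2 ⊢
  rw [e1, e2, re_add_im]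

/-! ### Privalov's theorem through Fourier projection. -/

/-- The periodic Cauchy kernel differs from the Cauchy kernel of the line by a continuous
function. -/
lemma exists_periodic_cauchy_kernel {L : ℝ} (hL : 0 < L) : ∃ e : ℂ → ℂ,
    ContinuousOn e {w | |w.re| ≤ L} ∧ ∀ w : ℂ, w ≠ 0 → |w.re| ≤ L →
      1 - exp (I * (Real.pi / L : ℝ) * w) ≠ 0 ∧
      (1 - exp (I * (Real.pi / L : ℝ) * w))⁻¹ = I / ((Real.pi / L : ℝ) * w) + e w := by
  set ω : ℝ := Real.pi / L with hω
  have hω0 : 0 < ω := div_pos Real.pi_pos hL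
  have hωc : (ω : ℂ) ≠ 0 := by exact_mod_cast hω0.ne'
  set f : ℂ → ℂ := fun w => 1 - exp (I * ω * w) with hf
  have hfd : Differentiable ℂ f := by fun_prop
  have hf0 : f 0 = 0 := by simp [hf]
  set d := dslope f 0 with hd
  have hdd : Differentiable ℂ d := by
    rw [← differentiableOn_univ, Complex.differentiableOn_dslope univ_mem]
    exact hfd.differentiableOn
  have hd0 : d 0 = -(I * ω) := by
    rw [hd, dslope_same]
    have h1 : HasDerivAt (fun w : ℂ => I * ω * w) (I * ω) 0 := by
      simpa using (hasDerivAt_id (0 : ℂ)).const_mul (I * ω)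
    have h2 := (h1.cexp).const_sub 1
    simp only [mul_zero, exp_zero, one_mul] at h2
    exact h2.deriv
  have hfw : ∀ w, f w = w * d w := fun w => by
    have := sub_smul_dslope f 0 w
    rw [hf0] at this
    simpa using this.symm
  have hfne : ∀ w : ℂ, w ≠ 0 → |w.re| ≤ L → f w ≠ 0 := by
    intro w hw hwL h0
    have h1 : exp (I * ω * w) = 1 := (sub_eq_zero.1 h0).symm
    obtain ⟨n, hn⟩ := Complex.exp_eq_one_iff.1 h1
    have h2 : w = (2 * L * n : ℝ) := by
      have h3 : (ω : ℂ) * w = (2 * Real.pi * n : ℝ) := by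
        have : I * ((ω : ℂ) * w) = I * (2 * Real.pi * n : ℝ) := by
          push_cast
          rw [← mul_assoc, hn]; ring
        exact mul_left_cancel₀ I_ne_zero this
      have h4 : (2 * Real.pi * n : ℝ) = ω * (2 * L * n) := by
        rw [hω]; field_simp
      rw [h4, ofReal_mul] at h3
      exact mul_left_cancel₀ hωc h3
    have hn0 : n ≠ 0 := by
      rintro rfl
      exact hw (by simpa using h2)
    rw [h2, ofReal_re, abs_mul, abs_of_pos (by positivity : 0 < 2 * L)] at hwL
    have : (1 : ℝ) ≤ |(n : ℝ)| := by exact_mod_cast Int.one_le_abs hn0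
    nlinarith
  have hd0' : d 0 ≠ 0 := by rw [hd0]; simp [hωc]
  have hdne : ∀ w : ℂ, |w.re| ≤ L → d w ≠ 0 := by
    intro w hwL h0
    by_cases hw : w = 0
    · subst hw
      exact hd0' h0
    · exact hfne w hw hwL (by rw [hfw, h0, mul_zero])
  have hqd : Differentiable ℂ (dslope d 0) := by
    rw [← differentiableOn_univ, Complex.differentiableOn_dslope univ_mem]
    exact hdd.differentiableOn
  -- Write `1 - exp(iωw) = w d(w)` with `d(0) = -iω`. Then `1/(w d) - 1/(w d(0)) = -((d - d(0))/w) /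
  -- (d d(0))`, and `d` has no zero in the strip because the zeros of `1 - exp(iωw)` are the
  -- multiples of `2L`.
  refine ⟨fun w => -(dslope d 0 w) / (d w * d 0), ?_, ?_⟩
  · refine ContinuousOn.div hqd.continuous.neg.continuousOn
      (hdd.continuous.mul continuous_const).continuousOn fun w hw => ?_
    exact mul_ne_zero (hdne w hw) hd0'
  · intro w hw hwL
    refine ⟨hfne w hw hwL, ?_⟩
    change (f w)⁻¹ = _
    have h1 : d w = d 0 + w * dslope d 0 w := by
      have := sub_smul_dslope d 0 w
      simp only [sub_zero, smul_eq_mul] at this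
      rw [this]; ring
    have h2 : I / (ω * w) = (w * d 0)⁻¹ := by
      rw [hd0]
      field_simp
      rw [I_sq]
    have h3 := hdne w hwL
    rw [h2, hfw]
    field_simp
    rw [h1]
    ring

/-- Disposes of the continuous remainders left when the periodic kernel is exchanged for that of the
line. -/
lemma exists_tendsto_integral_mul_continuousOn {L : ℝ} (hL : 0 < L) {e : ℂ → ℂ}
    (he : ContinuousOn e {w | |w.re| ≤ L}) {k : ℝ → ℂ} (hk : IntervalIntegrable k volume (-L) L) :
    ∃ l : ℂ, Tendsto (fun t : ℝ => ∫ σ in -L..L, k σ * e (σ + t * I)) (𝓝[>] 0) (𝓝 l) := by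
  have hc : IsCompact (Icc (-L) L ×ℂ Icc (0 : ℝ) 1) := isCompact_Icc.reProdIm isCompact_Icc
  obtain ⟨M, hM⟩ := hc.exists_bound_of_continuousOn
    (he.mono fun w hw => abs_le.2 (mem_reProdIm.1 hw).1)
  have hre : ∀ t : ℝ, MapsTo (fun σ : ℝ => (σ : ℂ) + t * I) (uIoc (-L) L) {w | |w.re| ≤ L} := by
    intro t σ hσ
    rw [uIoc_of_le (by linarith)] at hσ
    simpa using abs_le.2 ⟨hσ.1.le, hσ.2⟩
  refine ⟨∫ σ in -L..L, k σ * e σ,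
    intervalIntegral.tendsto_integral_filter_of_dominated_convergence
      (fun σ => ‖k σ‖ * M) ?_ ?_ (hk.norm.mul_const M) ?_⟩
  · refine Eventually.of_forall fun t => ?_
    refine (IntervalIntegrable.aestronglyMeasurable_restrict_uIoc hk).mul ?_
    refine ContinuousOn.aestronglyMeasurable ?_ measurableSet_uIoc
    exact he.comp (by fun_prop) (hre t)
  · filter_upwards [Ioc_mem_nhdsGT one_pos] with t ht
    refine Eventually.of_forall fun σ hσ => ?_
    rw [norm_mul]
    rw [uIoc_of_le (by linarith)] at hσ
    gcongr
    refine hM _ (mem_reProdIm.2 ⟨?_, ?_⟩)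
    · simpa using ⟨hσ.1.le, hσ.2⟩
    · simpa using ⟨ht.1.le, ht.2⟩
  · refine Eventually.of_forall fun σ hσ => ?_
    refine Tendsto.const_mul _ ?_
    have h1 : ContinuousWithinAt e {w | |w.re| ≤ L} σ := he σ (by simpa using hre 0 hσ)
    refine h1.tendsto.comp (tendsto_nhdsWithin_iff.2 ⟨?_, Eventually.of_forall fun t => hre t hσ⟩)
    have : Continuous fun t : ℝ => (σ : ℂ) + t * I := by fun_prop
    have := (this.tendsto 0).mono_left (nhdsWithin_le_nhds (s := Ioi 0))
    simpa using this

/-- Integration of the periodic Cauchy kernel against a function with vanishing Fourier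
coefficients of one sign. -/
lemma integral_periodic_cauchy_kernel {L : ℝ} (hL : 0 < L) {k : ℝ → ℂ}
    (hk : IntervalIntegrable k volume (-L) L)
    (h0 : ∀ n : ℕ, n ≠ 0 → ∫ σ in -L..L, k σ * exp (I * n * (Real.pi / L : ℝ) * σ) = 0)
    {t : ℝ} (ht : 0 < t) :
    ∫ σ in -L..L, k σ * (1 - exp (I * (Real.pi / L : ℝ) * (σ + t * I)))⁻¹
      = ∫ σ in -L..L, k σ := by
  set ω : ℝ := Real.pi / L with hω
  have hω0 : 0 < ω := div_pos Real.pi_pos hL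
  set r : ℝ := Real.exp (-(ω * t)) with hr
  have hr1 : r < 1 := Real.exp_lt_one_iff.2 (by have := mul_pos hω0 ht; linarith)
  have hr0 : 0 < r := Real.exp_pos _
  have hq : ∀ σ : ℝ, exp (I * ω * (σ + t * I)) = r * exp (I * ω * σ) := fun σ => by
    rw [hr, ofReal_exp, ← Complex.exp_add]
    congr 1
    push_cast
    ring_nf
    rw [I_sq]
    ring
  have hn : ∀ σ : ℝ, ‖exp (I * ω * σ)‖ = 1 := fun σ => by
    rw [Complex.norm_exp]
    simp
  have hqn : ∀ σ : ℝ, ‖exp (I * ω * (σ + t * I))‖ = r := fun σ => by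
    rw [hq, norm_mul, hn, mul_one, Complex.norm_real, Real.norm_eq_abs, abs_of_pos hr0]
  -- For `t > 0` the kernel is a geometric series of ratio `r = exp(-ωt) < 1` in modulus; only its
  -- term `n = 0` survives.
  have hs : HasSum (fun n : ℕ => ∫ σ in -L..L, k σ * exp (I * ω * (σ + t * I)) ^ n)
      (∫ σ in -L..L, k σ * (1 - exp (I * ω * (σ + t * I)))⁻¹) := by
    refine intervalIntegral.hasSum_integral_of_dominated_convergence (fun n σ => ‖k σ‖ * r ^ n)
      (fun n => ?_) (fun n => ?_) ?_ ?_ ?_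
    · have hcont : Continuous fun σ : ℝ => exp (I * ω * (σ + t * I)) ^ n := by fun_prop
      exact (IntervalIntegrable.aestronglyMeasurable_restrict_uIoc hk).mul
        hcont.aestronglyMeasurable
    · refine Eventually.of_forall fun σ _ => ?_
      rw [norm_mul, norm_pow, hqn]
    · exact Eventually.of_forall fun σ _ =>
        (summable_geometric_of_lt_one hr0.le hr1).mul_left _
    · simp only [tsum_mul_left]
      exact hk.norm.mul_const _
    · refine Eventually.of_forall fun σ _ => ?_
      have hlt : ‖exp (I * ω * (σ + t * I))‖ < 1 := (hqn σ).trans_lt hr1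
      have hgeo := hasSum_geometric_of_norm_lt_one hlt
      exact hgeo.mul_left (k σ)
  have hz : ∀ n : ℕ, n ≠ 0 → ∫ σ in -L..L, k σ * exp (I * ω * (σ + t * I)) ^ n = 0 := by
    intro n hn0
    have : ∀ σ : ℝ, k σ * exp (I * ω * (σ + t * I)) ^ n
        = (k σ * exp (I * n * ω * σ)) * (r : ℂ) ^ n := fun σ => by
      rw [hq, mul_pow, ← Complex.exp_nat_mul]
      ring_nf
    simp only [this]
    rw [intervalIntegral.integral_mul_const, h0 n hn0, zero_mul]
  have hs' := hasSum_single (f := fun n : ℕ => ∫ σ in -L..L, k σ * exp (I * ω * (σ + t * I)) ^ n)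
    0 hz
  simpa using hs.unique hs'
-- Recentring at `x` only multiplies a Fourier coefficient by a phase, so conditions on frequencies
-- hold at all `x` at once.
lemma integral_mul_exp_eq_fourierCoeff {L : ℝ} [hT : Fact (0 < 2 * L)]
    (F : AddCircle (2 * L) → ℂ) (m : ℤ) (x : ℝ) :
    ∫ σ in -L..L, F ((x + σ : ℝ) : AddCircle (2 * L)) * exp (-(I * m * (Real.pi / L : ℝ) * σ))
      = 2 * L * exp (I * m * (Real.pi / L : ℝ) * x) * fourierCoeff F m := by
  have hL : (L : ℂ) ≠ 0 := by
    have := hT.out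
    exact_mod_cast (by linarith : 0 < L).ne'
  have h1 : ∀ σ : ℝ, F ((x + σ : ℝ) : AddCircle (2 * L)) * exp (-(I * m * (Real.pi / L : ℝ) * σ))
      = exp (I * m * (Real.pi / L : ℝ) * x) *
        (fun y : ℝ => fourier (-m) (y : AddCircle (2 * L)) • F y) (x + σ) := by
    intro σ
    simp only [fourier_coe_apply, smul_eq_mul]
    rw [← mul_assoc, ← Complex.exp_add, mul_comm]
    congr 2
    push_cast
    field_simp
    ring
  simp only [h1]
  rw [intervalIntegral.integral_const_mul, intervalIntegral.integral_comp_add_left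
    (fun y : ℝ => fourier (-m) (y : AddCircle (2 * L)) • F y),
    fourierCoeff_eq_intervalIntegral F m (x + -L), Complex.real_smul]
  have h2 : x + -L + 2 * L = x + L := by ring
  rw [h2]
  push_cast
  field_simp

/-- The `L²` projection of a continuous periodic function onto the nonpositive frequencies. -/
lemma exists_nonpositive_frequency_part {L : ℝ} (hL : 0 < L) {g : ℝ → ℂ} (hg : Continuous g)
    (hper : Function.Periodic g (2 * L)) :
    ∃ h : ℝ → ℂ, (∀ a b, IntervalIntegrable h volume a b) ∧
      (∀ (x : ℝ) (n : ℕ), ∫ σ in -L..L, h (x + σ) * exp (I * n * (Real.pi / L : ℝ) * σ)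
        = ∫ σ in -L..L, g (x + σ) * exp (I * n * (Real.pi / L : ℝ) * σ)) ∧
      (∀ (x : ℝ) (n : ℕ), n ≠ 0 →
        ∫ σ in -L..L, (starRingEnd ℂ) (h (x + σ)) * exp (I * n * (Real.pi / L : ℝ) * σ) = 0) := by
  have hT : Fact (0 < 2 * L) := ⟨by linarith⟩
  have hGc : Continuous hper.lift := hg.quotient_lift _
  set G : C(AddCircle (2 * L), ℂ) := ⟨hper.lift, hGc⟩ with hG
  set G₂ : Lp ℂ 2 (@AddCircle.haarAddCircle (2 * L) hT) :=
    ContinuousMap.toLp (E := ℂ) 2 AddCircle.haarAddCircle ℂ G with hG₂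
  have hG₂c : ∀ m, fourierCoeff G₂ m = fourierCoeff hper.lift m := fun m => fourierCoeff_toLp G m
  set a := fourierBasis.repr G₂ with ha
  -- Truncating a square summable sequence keeps it so. The projection is known only to be in `L²`,
  -- which is why Fatou's theorem is needed for locally integrable functions.
  have hmem : Memℓp (fun m : ℤ => if m ≤ 0 then a m else 0) 2 := by
    refine memℓp_gen ?_
    have hs := (memℓp_gen_iff (by norm_num)).1 (lp.memℓp a)
    refine Summable.of_nonneg_of_le (fun m => by positivity) (fun m => ?_) hs
    split_ifs
    · exact le_rfl
    · rw [norm_zero, Real.zero_rpow (by norm_num)]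
      positivity
  set H : Lp ℂ 2 (@AddCircle.haarAddCircle (2 * L) hT) :=
    fourierBasis.repr.symm ⟨_, hmem⟩ with hH
  have hHc : ∀ m : ℤ, fourierCoeff H m = if m ≤ 0 then fourierCoeff hper.lift m else 0 := by
    intro m
    rw [← fourierBasis_repr, hH, LinearIsometryEquiv.apply_symm_apply, ← hG₂c, ← fourierBasis_repr]
  have hexp : ∀ (n : ℕ) (σ : ℝ), exp (I * n * (Real.pi / L : ℝ) * σ)
      = exp (-(I * ((-n : ℤ) : ℂ) * (Real.pi / L : ℝ) * σ)) := fun n σ => by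
    congr 1
    push_cast
    ring
  refine ⟨fun x => H (x : AddCircle (2 * L)), ?_, ?_, ?_⟩
  · have hp : Function.Periodic (fun x : ℝ => H (x : AddCircle (2 * L))) (2 * L) := fun x => by
      simp
    refine hp.intervalIntegrable hT.out.ne' (t := 0) ?_
    have hHi : Integrable H (volume : Measure (AddCircle (2 * L))) := by
      rw [AddCircle.volume_eq_smul_haarAddCircle]
      refine Integrable.smul_measure ?_ (by finiteness)
      exact (Lp.memLp H).integrable (by norm_num)
    rw [intervalIntegrable_iff, uIoc_of_le (by linarith)]
    exact (AddCircle.measurePreserving_mk (2 * L) 0).integrable_comp_of_integrable hHi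
  · intro x n
    have h1 : ∀ y : ℝ, g y = hper.lift (y : AddCircle (2 * L)) := fun y => rfl
    simp only [h1, hexp, integral_mul_exp_eq_fourierCoeff, hHc]
    simp
  · intro x n hn
    have h1 := integral_mul_exp_eq_fourierCoeff (L := L) H n x
    rw [hHc, if_neg (by simpa using hn), mul_zero] at h1
    have h2 := congrArg (starRingEnd ℂ) h1
    rw [← intervalIntegral.intervalIntegral_conj, map_zero] at h2
    rw [← h2]
    refine intervalIntegral.integral_congr fun σ _ => ?_
    simp only [map_mul, ← Complex.exp_conj, map_neg, conj_I, conj_ofReal]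
    congr 2
    push_cast
    simp

/-- **Privalov's theorem** for continuous densities: the Cauchy integral has vertical limits almost
everywhere. -/
lemma ae_exists_tendsto_cauchy {L : ℝ} (hL : 0 < L) {g : ℝ → ℂ} (hg : Continuous g)
    (hper : Function.Periodic g (2 * L)) :
    ∀ᵐ x : ℝ, ∃ l : ℂ, Tendsto (fun t : ℝ => ∫ σ in -L..L, g (x + σ) * (σ + t * I : ℂ)⁻¹)
      (𝓝[>] 0) (𝓝 l) := by
  obtain ⟨h, hhI, hhg, hhc⟩ := exists_nonpositive_frequency_part hL hg hper
  obtain ⟨e, hec, he⟩ := exists_periodic_cauchy_kernel hL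
  have hloc : LocallyIntegrable h volume := by
    intro x
    refine ⟨Ioc (x - 1) (x + 1), Ioc_mem_nhds (by linarith) (by linarith), (hhI _ _).1⟩
  filter_upwards [ae_exists_tendsto_poisson hL hloc] with x hx
  obtain ⟨lP, hlP⟩ := hx
  have hkI : IntervalIntegrable (fun σ => h (x + σ)) volume (-L) L := by
    have := (hhI (x + -L) (x + L)).comp_add_left x
    simpa using this
  have hgc : Continuous fun σ => g (x + σ) := by fun_prop
  have hgI : IntervalIntegrable (fun σ => g (x + σ)) volume (-L) L := hgc.intervalIntegrable _ _
  obtain ⟨l₁, hl₁⟩ := exists_tendsto_integral_mul_continuousOn hL hec hkI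
  obtain ⟨l₂, hl₂⟩ := exists_tendsto_integral_mul_continuousOn hL
    (e := fun w => (starRingEnd ℂ) (e w)) (continuous_conj.comp_continuousOn hec) hkI
  obtain ⟨l₃, hl₃⟩ := exists_tendsto_integral_mul_continuousOn hL hec hgI
  set ω : ℝ := Real.pi / L with hω
  have hω0 : 0 < ω := div_pos Real.pi_pos hL
  have hωc : (ω : ℂ) ≠ 0 := by exact_mod_cast hω0.ne'
  set Q : ℝ → ℝ → ℂ := fun t σ => (1 - exp (I * ω * (σ + t * I)))⁻¹ with hQ
  have hne : ∀ t : ℝ, 0 < t → ∀ σ : ℝ, (σ + t * I : ℂ) ≠ 0 := fun t ht σ h0 => by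
    have := congrArg Complex.im h0
    simp at this
    exact ht.ne' this
  have hmem : ∀ t σ : ℝ, σ ∈ uIcc (-L) L → |(σ + t * I : ℂ).re| ≤ L := fun t σ hσ => by
    rw [uIcc_of_le (by linarith)] at hσ
    simpa using abs_le.2 hσ
  have hQc : ∀ t : ℝ, 0 < t → ContinuousOn (Q t) (uIcc (-L) L) := fun t ht => by
    refine ContinuousOn.inv₀ (by fun_prop) fun σ hσ => ?_
    exact (he _ (hne t ht σ) (hmem t σ hσ)).1
  have hec' : ∀ t : ℝ, ContinuousOn (fun σ : ℝ => e (σ + t * I)) (uIcc (-L) L) := fun t =>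
    hec.comp (by fun_prop) (hmem t)
  -- `Q` sees only the nonpositive frequencies of the density, so `∫ g Q = ∫ h Q`; and `∫ h Q̄ = ∫
  -- h`, because `h` has no positive frequencies. Adding `Q̄` thus costs a constant, and `Q + Q̄` is
  -- a Poisson kernel up to a continuous remainder.
  have hQint : ∀ t : ℝ, 0 < t →
      ∫ σ in -L..L, g (x + σ) * Q t σ = (∫ σ in -L..L, h (x + σ) * (Q t σ + conj (Q t σ)))
        - ∫ σ in -L..L, h (x + σ) := by
    intro t ht
    have h1 := integral_periodic_cauchy_kernel hL (hgI.sub hkI) (fun n hn => by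
      simp only [sub_mul]
      rw [intervalIntegral.integral_sub, hhg x n, sub_self]
      · exact hgI.mul_continuousOn (by fun_prop)
      · exact hkI.mul_continuousOn (by fun_prop)) ht
    have h2 := integral_periodic_cauchy_kernel hL (k := fun σ => conj (h (x + σ)))
      ⟨(conjCLE : ℂ →L[ℝ] ℂ).integrable_comp hkI.1, (conjCLE : ℂ →L[ℝ] ℂ).integrable_comp hkI.2⟩
      (hhc x) ht
    have h3 : ∫ σ in -L..L, h (x + σ) * conj (Q t σ) = ∫ σ in -L..L, h (x + σ) := by
      have := congrArg (starRingEnd ℂ) h2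
      rw [← intervalIntegral.intervalIntegral_conj, ← intervalIntegral.intervalIntegral_conj] at this
      simpa only [map_mul, Complex.conj_conj] using this
    have h0 := hhg x 0
    simp only [Nat.cast_zero, mul_zero, zero_mul, exp_zero, mul_one] at h0
    simp only [sub_mul] at h1
    rw [intervalIntegral.integral_sub (hgI.mul_continuousOn (hQc t ht))
      (hkI.mul_continuousOn (hQc t ht)), intervalIntegral.integral_sub hgI hkI, h0, sub_self,
      sub_eq_zero] at h1
    have hcI : IntervalIntegrable (fun σ => h (x + σ) * conj (Q t σ)) volume (-L) L :=
      hkI.mul_continuousOn (continuous_conj.comp_continuousOn (hQc t ht))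
    simp only [mul_add]
    rw [intervalIntegral.integral_add (hkI.mul_continuousOn (hQc t ht)) hcI, h3,
      add_sub_cancel_right]
    exact h1
  refine ⟨_, ((((((hlP.const_mul (2 / ω : ℂ)).add hl₁).add hl₂).sub_const
    (∫ σ in -L..L, h (x + σ))).sub hl₃).const_mul (ω / I)).congr' ?_⟩
  filter_upwards [self_mem_nhdsWithin] with t ht
  have ht : 0 < t := ht
  have hPc : Continuous fun σ : ℝ => ((t / (σ ^ 2 + t ^ 2) : ℝ) : ℂ) :=
    continuous_ofReal.comp
      (Continuous.div (by fun_prop) (by fun_prop) fun σ => by positivity)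
  have h1 : ∫ σ in -L..L, h (x + σ) * (Q t σ + conj (Q t σ))
      = 2 / ω * (∫ σ in -L..L, h (x + σ) * ((t / (σ ^ 2 + t ^ 2) : ℝ) : ℂ))
        + (∫ σ in -L..L, h (x + σ) * e (σ + t * I))
        + ∫ σ in -L..L, h (x + σ) * conj (e (σ + t * I)) := by
    rw [← intervalIntegral.integral_const_mul, ← intervalIntegral.integral_add,
      ← intervalIntegral.integral_add]
    · refine intervalIntegral.integral_congr fun σ hσ => ?_
      have h2 : Q t σ = _ := (he _ (hne t ht σ) (hmem t σ hσ)).2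
      have h3 : I / (ω * (σ + t * I)) + conj (I / (ω * (σ + t * I)))
          = 2 / ω * ((t / (σ ^ 2 + t ^ 2) : ℝ) : ℂ) := by
        have n1 := hne t ht σ
        have n2 : (σ - t * I : ℂ) ≠ 0 := by
          have := (map_ne_zero (starRingEnd ℂ)).2 n1
          simpa [sub_eq_add_neg] using this
        have n3 : ((σ : ℂ) ^ 2 + t ^ 2) = (σ + t * I) * (σ - t * I) := by
          ring_nf
          rw [I_sq]
          ring
        have n4 : conj (σ + t * I : ℂ) = σ - t * I := by
          simp [sub_eq_add_neg]
        rw [map_div₀, map_mul, n4, conj_I, conj_ofReal]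
        push_cast
        rw [n3]
        have n5 : (σ + t * I : ℂ) - (σ - t * I) = 2 * t * I := by ring
        generalize (σ + t * I : ℂ) = a at n1 n5 ⊢
        generalize (σ - t * I : ℂ) = b at n2 n5 ⊢
        field_simp
        linear_combination -I * n5 - 2 * t * I_sq
      rw [h2, map_add]
      linear_combination h (x + σ) * h3
    · exact ((hkI.mul_continuousOn hPc.continuousOn).const_mul _).add
        (hkI.mul_continuousOn (hec' t))
    · exact hkI.mul_continuousOn (continuous_conj.comp_continuousOn (hec' t))
    · exact (hkI.mul_continuousOn hPc.continuousOn).const_mul _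
    · exact hkI.mul_continuousOn (hec' t)
  have h4 : ∫ σ in -L..L, g (x + σ) * Q t σ
      = I / ω * (∫ σ in -L..L, g (x + σ) * (σ + t * I : ℂ)⁻¹)
        + ∫ σ in -L..L, g (x + σ) * e (σ + t * I) := by
    rw [← intervalIntegral.integral_const_mul, ← intervalIntegral.integral_add]
    · refine intervalIntegral.integral_congr fun σ hσ => ?_
      have h2 : Q t σ = _ := (he _ (hne t ht σ) (hmem t σ hσ)).2
      rw [h2, div_eq_mul_inv, mul_inv]
      ring
    · refine (hgI.mul_continuousOn (ContinuousOn.inv₀ (by fun_prop) fun σ _ => ?_)).const_mul _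
      exact hne t ht σ
    · exact hgI.mul_continuousOn (hec' t)
  rw [← h1, ← hQint t ht, h4, add_sub_cancel_right]
  field_simp

lemma isOddKernel_conj_inv : IsOddKernel (fun w => (conj w)⁻¹) 1 where
  smul t w := by
    simp only [map_mul, conj_ofReal, mul_inv]
  lip a b ha hb := by
    have ha' : conj a ≠ 0 := (map_ne_zero _).2 ha
    have hb' : conj b ≠ 0 := (map_ne_zero _).2 hb
    rw [inv_sub_inv ha' hb', ← map_sub, ← map_mul, norm_div, norm_conj, norm_conj, norm_mul,
      norm_sub_rev, one_mul]

/-- On the tangent line, `|τ| = 1` makes the kernel `1/w̄` equal to `-τ` times the conjugate of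
`1/(σ + it)`. -/
lemma IsArc.exists_tendsto_conj_cauchy {L : ℝ} {τ : ℂ} {γ : ℝ → ℂ} (h : IsArc L τ γ) {g : ℝ → ℂ}
    (hg : Continuous g)
    (hc : ∃ l : ℂ, Tendsto (fun t : ℝ => ∫ σ in -L..L, conj (g σ) * (σ + t * I : ℂ)⁻¹)
      (𝓝[>] 0) (𝓝 l)) :
    ∃ l : ℂ, Tendsto (fun t : ℝ => ∫ σ in -L..L, g σ * (conj (t * (-I * τ) - γ σ))⁻¹)
      (𝓝[>] 0) (𝓝 l) := by
  refine h.exists_tendsto_of_straight isOddKernel_conj_inv hg ?_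
  obtain ⟨l, hl⟩ := hc
  refine ⟨_, (((continuous_conj.tendsto l).comp hl).const_mul (-τ)).congr fun t => ?_⟩
  rw [Function.comp_apply, ← intervalIntegral.intervalIntegral_conj, ← intervalIntegral.integral_const_mul]
  refine intervalIntegral.integral_congr fun σ _ => ?_
  have h1 : τ * conj τ = 1 := by rw [mul_conj, normSq_eq_norm_sq, h.norm_tangent]; simp
  have h2 : conj (t * (-I * τ) - σ * τ) = -(conj τ * (conj (σ + t * I : ℂ))) := by
    simp only [map_sub, map_mul, map_neg, map_add, conj_I, conj_ofReal]
    ring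
  have h3 : (conj τ)⁻¹ = τ := inv_eq_of_mul_eq_one_right (by rwa [mul_comm])
  rw [h2, inv_neg, mul_inv, h3, map_mul, conj_conj, map_inv₀]
  ring

/-! ### The kernels `1/w` and `w/w̄²`, and the jump constants. -/

lemma isOddKernel_inv : IsOddKernel (fun w => w⁻¹) 1 where
  smul t w := mul_inv _ _
  lip a b ha hb := by
    rw [inv_sub_inv ha hb, norm_div, norm_mul, norm_sub_rev, one_mul]

lemma isOddKernel_div_conj_sq : IsOddKernel (fun w => w / (conj w) ^ 2) 3 where
  smul t w := by
    simp only [map_mul, conj_ofReal]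
    by_cases ht : (t : ℂ) = 0
    · simp [ht]
    · field_simp
  lip a b ha hb := by
    -- In the splitting below the first term contributes `1` because `1/|a|² ≤ 1/(|a||b|)`, and the
    -- second `2` because `|ā + b̄| ≤ 2|a|`; hence the constant `3`.
    wlog hab : ‖b‖ ≤ ‖a‖ generalizing a b
    · have := this b a hb ha (le_of_not_ge hab)
      rw [norm_sub_rev, norm_sub_rev b a, mul_comm ‖b‖] at this
      exact this
    have ha' : conj a ≠ 0 := (map_ne_zero _).2 ha
    have hb' : conj b ≠ 0 := (map_ne_zero _).2 hb
    have ha0 : 0 < ‖a‖ := norm_pos_iff.2 ha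
    have hb0 : 0 < ‖b‖ := norm_pos_iff.2 hb
    have e : a / conj a ^ 2 - b / conj b ^ 2 = (a - b) / conj a ^ 2
        + b * (conj (b - a) * (conj b + conj a)) / (conj a ^ 2 * conj b ^ 2) := by
      rw [map_sub]
      field_simp
      ring
    rw [e]
    refine (norm_add_le _ _).trans ?_
    rw [norm_div, norm_div, norm_mul, norm_mul, norm_mul, norm_pow, norm_pow, norm_conj, norm_conj,
      norm_conj, norm_sub_rev b a]
    have h1 : ‖conj b + conj a‖ ≤ 2 * ‖a‖ := by
      refine (norm_add_le _ _).trans ?_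
      rw [norm_conj, norm_conj]
      linarith
    calc ‖a - b‖ / ‖a‖ ^ 2 + ‖b‖ * (‖a - b‖ * ‖conj b + conj a‖) / (‖a‖ ^ 2 * ‖b‖ ^ 2)
        ≤ ‖a - b‖ / (‖a‖ * ‖b‖) + ‖b‖ * (‖a - b‖ * (2 * ‖a‖)) / (‖a‖ ^ 2 * ‖b‖ ^ 2) := by
          gcongr
          rw [sq]
          gcongr
      _ = 3 * ‖a - b‖ / (‖a‖ * ‖b‖) := by
          field_simp
          norm_num

section JumpConstants

variable {τ : ℂ}

lemma mul_conj_eq_one (hτ : ‖τ‖ = 1) : τ * conj τ = 1 := by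
  rw [mul_conj, normSq_eq_norm_sq, hτ]; simp

lemma I_sub_ofReal_ne_zero (r : ℝ) : (I - r : ℂ) ≠ 0 := fun h => by
  simpa using congrArg Complex.im h

lemma neg_I_sub_ofReal_ne_zero (r : ℝ) : (-I - r : ℂ) ≠ 0 := fun h => by
  simpa using congrArg Complex.im h

lemma one_add_sq_eq (r : ℝ) : (1 + (r : ℂ) ^ 2) = (I - r) * (-I - r) := by
  ring_nf
  rw [I_sq]
  ring

lemma conj_normal_sub (hτ : ‖τ‖ = 1) (r : ℝ) :
    conj ((-I * τ) - r * τ) = τ⁻¹ * (I - r) ∧ conj (-(-I * τ) - r * τ) = τ⁻¹ * (-I - r) := by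
  have h : τ⁻¹ = conj τ := inv_eq_of_mul_eq_one_right (mul_conj_eq_one hτ)
  rw [h]
  constructor
  · simp only [map_sub, map_mul, map_neg, conj_I, conj_ofReal]
    ring
  · simp only [map_sub, map_mul, map_neg, conj_I, conj_ofReal]
    ring

lemma integral_one_add_sq_inv_ofReal : ∫ r : ℝ, ((1 : ℂ) + (r : ℂ) ^ 2)⁻¹ = Real.pi := by
  have h := integral_univ_inv_one_add_sq
  rw [← h, ← integral_complex_ofReal]
  congr 1
  funext r
  push_cast
  rfl

lemma integral_jump_conj_inv (hτ : ‖τ‖ = 1) :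
    ∫ r : ℝ, ((conj ((-I * τ) - r * τ))⁻¹ - (conj (-(-I * τ) - r * τ))⁻¹)
      = -(2 * Real.pi * I * τ) := by
  have h : ∀ r : ℝ, (conj ((-I * τ) - r * τ))⁻¹ - (conj (-(-I * τ) - r * τ))⁻¹
      = -(2 * I * τ) * ((1 : ℂ) + (r : ℂ) ^ 2)⁻¹ := fun r => by
    rw [(conj_normal_sub hτ r).1, (conj_normal_sub hτ r).2, one_add_sq_eq]
    have h1 := I_sub_ofReal_ne_zero r
    have h2 := neg_I_sub_ofReal_ne_zero r
    rw [mul_inv, mul_inv, mul_inv, inv_inv]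
    field_simp
    ring
  simp only [h]
  rw [integral_const_mul, integral_one_add_sq_inv_ofReal]
  ring

lemma integral_jump_inv (hτ : ‖τ‖ = 1) :
    ∫ r : ℝ, (((-I * τ) - r * τ)⁻¹ - (-(-I * τ) - r * τ)⁻¹) = 2 * Real.pi * I * conj τ := by
  have h := congrArg conj (integral_jump_conj_inv hτ)
  rw [← integral_conj] at h
  simpa [map_ofNat] using h

/-- The integrand is the derivative of `r / (1 + r²)`, which vanishes at both ends. -/
lemma integral_one_sub_sq_div : ∫ r : ℝ, (1 - r ^ 2) / (1 + r ^ 2) ^ 2 = 0 ∧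
    Integrable fun r : ℝ => (1 - r ^ 2) / (1 + r ^ 2) ^ 2 := by
  have hi : Integrable fun r : ℝ => (1 - r ^ 2) / (1 + r ^ 2) ^ 2 := by
    refine integrable_inv_one_add_sq.mono' ?_ (Eventually.of_forall fun r => ?_)
    · exact (Continuous.div (by fun_prop) (by fun_prop)
        fun r => by positivity).aestronglyMeasurable
    · rw [norm_div, Real.norm_eq_abs, Real.norm_eq_abs, abs_of_pos (by positivity : 0 < (1 + r ^ 2) ^ 2),
        div_le_iff₀ (by positivity)]
      have : (1 + r ^ 2)⁻¹ * (1 + r ^ 2) ^ 2 = 1 + r ^ 2 := by field_simp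
      rw [this, abs_le]
      constructor <;> nlinarith [sq_nonneg r]
  have hd : ∀ r : ℝ, HasDerivAt (fun r : ℝ => r / (1 + r ^ 2)) ((1 - r ^ 2) / (1 + r ^ 2) ^ 2) r := by
    intro r
    have h1 : HasDerivAt (fun r : ℝ => 1 + r ^ 2) (2 * r) r := by
      simpa using (hasDerivAt_pow 2 r).const_add 1
    refine ((hasDerivAt_id r).div h1 (by positivity)).congr_deriv ?_
    simp only [id]
    ring
  have hb : ∀ r : ℝ, r ≠ 0 → ‖r / (1 + r ^ 2)‖ ≤ |r|⁻¹ := fun r hr => by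
    have hr' := abs_pos.2 hr
    rw [norm_div, Real.norm_eq_abs, Real.norm_eq_abs, abs_of_pos (by positivity : 0 < 1 + r ^ 2),
      div_le_iff₀ (by positivity), inv_mul_eq_div, le_div_iff₀ hr']
    nlinarith [sq_abs r]
  have ht : Tendsto (fun r : ℝ => r / (1 + r ^ 2)) atTop (𝓝 0) := by
    refine squeeze_zero_norm' ?_ (tendsto_inv_atTop_zero.comp tendsto_abs_atTop_atTop)
    filter_upwards [eventually_ne_atTop 0] with r hr using hb r hr
  have ht' : Tendsto (fun r : ℝ => r / (1 + r ^ 2)) atBot (𝓝 0) := by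
    refine squeeze_zero_norm' ?_ (tendsto_inv_atTop_zero.comp tendsto_abs_atBot_atTop)
    filter_upwards [eventually_ne_atBot 0] with r hr using hb r hr
  refine ⟨?_, hi⟩
  rw [integral_of_hasDerivAt_of_tendsto hd hi ht' ht, sub_zero]

/-- The difference splits into a multiple of `(1 - r²)/(1 + r²)²`, of integral zero, and `-2iτ³/(1 +
r²)`. -/
lemma integral_jump_div_conj_sq (hτ : ‖τ‖ = 1) :
    ∫ r : ℝ, (((-I * τ) - r * τ) / (conj ((-I * τ) - r * τ)) ^ 2
      - (-(-I * τ) - r * τ) / (conj (-(-I * τ) - r * τ)) ^ 2) = -(2 * Real.pi * I * τ ^ 3) := by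
  obtain ⟨hz, hzi⟩ := integral_one_sub_sq_div
  have hτ0 : τ ≠ 0 := by rw [← norm_pos_iff, hτ]; exact one_pos
  have h : ∀ r : ℝ, ((-I * τ) - r * τ) / (conj ((-I * τ) - r * τ)) ^ 2
      - (-(-I * τ) - r * τ) / (conj (-(-I * τ) - r * τ)) ^ 2
      = (4 * I * τ ^ 3) * (((1 - r ^ 2) / (1 + r ^ 2) ^ 2 : ℝ) : ℂ)
        + (-2 * I * τ ^ 3) * ((1 : ℂ) + (r : ℂ) ^ 2)⁻¹ := fun r => by
    rw [(conj_normal_sub hτ r).1, (conj_normal_sub hτ r).2]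
    push_cast
    rw [one_add_sq_eq]
    have h1 := I_sub_ofReal_ne_zero r
    have h2 := neg_I_sub_ofReal_ne_zero r
    have e1 : -I * τ - r * τ = τ * (-I - r) := by ring
    have e2 : -(-I * τ) - r * τ = τ * (I - r) := by ring
    rw [e1, e2]
    have key : (4 * I * (1 - (r : ℂ) ^ 2) - 2 * I * ((I - r) * (-I - r)))
        = (-I - r) ^ 3 - (I - r) ^ 3 := by
      ring_nf
      have : I ^ 3 = -I := by rw [pow_succ, I_sq]; ring
      rw [this]
      ring
    generalize (I - r : ℂ) = a at h1 key ⊢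
    generalize (-I - r : ℂ) = b at h2 key ⊢
    field_simp
    linear_combination -key
  simp only [h]
  have i1 : Integrable fun r : ℝ => (4 * I * τ ^ 3) * (((1 - r ^ 2) / (1 + r ^ 2) ^ 2 : ℝ) : ℂ) :=
    hzi.ofReal.const_mul _
  have i2 : Integrable fun r : ℝ => (-2 * I * τ ^ 3) * ((1 : ℂ) + (r : ℂ) ^ 2)⁻¹ := by
    have : Integrable fun r : ℝ => (((1 + r ^ 2)⁻¹ : ℝ) : ℂ) := integrable_inv_one_add_sq.ofReal
    push_cast at this
    exact this.const_mul _
  rw [integral_add i1 i2, integral_const_mul, integral_const_mul, integral_complex_ofReal, hz,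
    integral_one_add_sq_inv_ofReal]
  push_cast
  ring

end JumpConstants

/-! ### Dini continuity. -/

/-- Dini continuity at `s`. -/
def IsDiniAt (L : ℝ) (g : ℝ → ℂ) (s : ℝ) : Prop :=
  IntervalIntegrable (fun σ => |σ|⁻¹ * ‖g (s + σ) - g s‖) volume (-L) L

namespace IsDiniAt

variable {L s : ℝ} {g h : ℝ → ℂ}

lemma of_le (hg : Continuous g) {u : ℝ → ℝ}
    (hu : IntervalIntegrable u volume (-L) L)
    (hle : ∀ σ, σ ∈ uIoc (-L) L → |σ|⁻¹ * ‖g (s + σ) - g s‖ ≤ u σ) : IsDiniAt L g s := by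
  refine hu.mono_fun' ?_ ?_
  · have := hg.measurable
    exact Measurable.aestronglyMeasurable (by fun_prop)
  · refine (ae_restrict_iff' measurableSet_uIoc).2 (Eventually.of_forall fun σ hσ => ?_)
    simp only [norm_mul, norm_inv, Real.norm_eq_abs, abs_abs, abs_norm]
    exact hle σ hσ

lemma of_holder (hL : 0 < L) (hg : Continuous g) {C κ : ℝ} (hκ : 0 < κ)
    (hle : ∀ σ, |σ| ≤ L → ‖g (s + σ) - g s‖ ≤ C * |σ| ^ κ) : IsDiniAt L g s := by
  have h1 : IntervalIntegrable (fun σ : ℝ => |σ| ^ (κ - 1)) volume 0 L := by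
    have := intervalIntegral.intervalIntegrable_rpow' (a := 0) (b := L) (r := κ - 1) (by linarith)
    refine this.congr fun σ hσ => ?_
    rw [uIoc_of_le hL.le] at hσ
    rw [abs_of_pos hσ.1]
  have h2 : IntervalIntegrable (fun σ : ℝ => |σ| ^ (κ - 1)) volume (-L) 0 := by
    have := (h1.comp_mul_left (c := -1)).symm
    simpa [div_neg] using this
  refine of_le hg ((h2.trans h1).const_mul C) fun σ hσ => ?_
  rw [uIoc_of_le (by linarith)] at hσ
  have hσ' : |σ| ≤ L := abs_le.2 ⟨hσ.1.le, hσ.2⟩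
  by_cases h0 : σ = 0
  · subst h0
    -- At `σ = 0` the left side is `0` since `0⁻¹ = 0`, but `0 ^ (κ - 1)` is `1` when `κ = 1`; so
    -- the sign of `C` matters, and it is read off at `σ = L`.
    have hC : 0 ≤ C := by
      have := (norm_nonneg _).trans (hle L (abs_of_pos hL).le)
      have hp : 0 < |L| ^ κ := Real.rpow_pos_of_pos (abs_pos.2 hL.ne') _
      exact nonneg_of_mul_nonneg_left this hp
    simp only [abs_zero, inv_zero, zero_mul]
    positivity
  · have hp := abs_pos.2 h0
    calc |σ|⁻¹ * ‖g (s + σ) - g s‖ ≤ |σ|⁻¹ * (C * |σ| ^ κ) := by gcongr; exact hle σ hσ'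
      _ = C * |σ| ^ (κ - 1) := by rw [Real.rpow_sub_one hp.ne']; field_simp

lemma of_contDiff (hL : 0 < L) (hg : ContDiff ℝ 1 g) : IsDiniAt L g s := by
  obtain ⟨M, hM⟩ : ∃ M : ℝ, ∀ r ∈ Icc (s - L) (s + L), ‖deriv g r‖ ≤ M :=
    isCompact_Icc.exists_bound_of_continuousOn (hg.continuous_deriv le_rfl).continuousOn
  refine of_holder hL hg.continuous one_pos (C := M) fun σ hσ => ?_
  rw [abs_le] at hσ
  rw [Real.rpow_one]
  have := (convex_Icc (s - L) (s + L)).norm_image_sub_le_of_norm_deriv_le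
    (fun r _ => (hg.differentiable one_ne_zero).differentiableAt) hM
    (x := s) (y := s + σ) ⟨by linarith, by linarith⟩ ⟨by linarith, by linarith⟩
  simpa using this

lemma conjugate (hg : IsDiniAt L g s) : IsDiniAt L (fun r => conj (g r)) s := by
  refine hg.congr fun σ _ => ?_
  rw [← map_sub, norm_conj]

lemma add (hgc : Continuous g) (hhc : Continuous h) (hg : IsDiniAt L g s) (hh : IsDiniAt L h s) :
    IsDiniAt L (fun r => g r + h r) s := by
  refine of_le (hgc.add hhc) (IntervalIntegrable.add hg hh) fun σ _ => ?_
  rw [← mul_add]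
  gcongr
  rw [add_sub_add_comm]
  exact norm_add_le _ _

lemma mul (hgc : Continuous g) (hhc : Continuous h) (hg : IsDiniAt L g s) (hh : IsDiniAt L h s) :
    IsDiniAt L (fun r => g r * h r) s := by
  have hc : Continuous fun σ : ℝ => ‖h (s + σ)‖ := by fun_prop
  refine of_le (hgc.mul hhc)
    ((IntervalIntegrable.mul_continuousOn hg hc.continuousOn).add
      (IntervalIntegrable.mul_const hh ‖g s‖)) fun σ _ => ?_
  rw [mul_assoc, mul_assoc, ← mul_add]
  gcongr
  have : g (s + σ) * h (s + σ) - g s * h s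
      = (g (s + σ) - g s) * h (s + σ) + (h (s + σ) - h s) * g s := by ring
  rw [this]
  refine (norm_add_le _ _).trans ?_
  rw [norm_mul, norm_mul]

end IsDiniAt

/-! ### Closed curves of class `C²`. -/

/-- A closed simple curve of class `C²` in the complex plane, of length `2 * L` and parametrized
periodically by arclength. -/
structure IsC2Curve (L : ℝ) (Z : ℝ → ℂ) : Prop where
  pos : 0 < L
  contDiff : ContDiff ℝ 2 Z
  periodic : Function.Periodic Z (2 * L)
  unit_speed : ∀ s, ‖deriv Z s‖ = 1
  simple : ∀ s σ, σ ≠ 0 → |σ| ≤ L → Z (s + σ) ≠ Z s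

namespace IsC2Curve

variable {L : ℝ} {Z : ℝ → ℂ}

lemma contDiff_deriv (h : IsC2Curve L Z) : ContDiff ℝ 1 (deriv Z) :=
  (contDiff_succ_iff_deriv.1 h.contDiff).2.2

lemma hasDerivAt (h : IsC2Curve L Z) (s : ℝ) : HasDerivAt Z (deriv Z s) s :=
  (h.contDiff.differentiable two_ne_zero s).hasDerivAt

lemma isArc (h : IsC2Curve L Z) (s : ℝ) : IsArc L (deriv Z s) fun σ => Z (s + σ) - Z s where
  pos := h.pos
  norm_tangent := h.unit_speed s
  continuous := by
    have := h.contDiff.continuous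
    fun_prop
  ne_zero σ hσ hσ' := sub_ne_zero.2 (h.simple s σ hσ hσ')
  contact := by
    have hL := h.pos
    obtain ⟨M, hM⟩ : ∃ M : ℝ, ∀ r ∈ Icc (s - L) (s + L), ‖deriv (deriv Z) r‖ ≤ M :=
      isCompact_Icc.exists_bound_of_continuousOn
        (h.contDiff_deriv.continuous_deriv le_rfl).continuousOn
    have hM0 : 0 ≤ M := (norm_nonneg _).trans (hM s ⟨by linarith, by linarith⟩)
    refine ⟨M, hM0, fun σ hσ => ?_⟩
    have hd : ∀ r, |r| ≤ |σ| → ‖deriv Z (s + r) - deriv Z s‖ ≤ M * |σ| := fun r hr => by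
      have hr' := abs_le.1 (hr.trans hσ)
      have := (convex_Icc (s - L) (s + L)).norm_image_sub_le_of_norm_deriv_le
        (fun r _ => (h.contDiff_deriv.differentiable one_ne_zero).differentiableAt) hM
        (x := s) (y := s + r) ⟨by linarith, by linarith⟩ ⟨by linarith, by linarith⟩
      refine this.trans ?_
      rw [add_sub_cancel_left, Real.norm_eq_abs]
      gcongr
    -- The mean value inequality, applied first to `Z'` and then to this function, gives the contact
    -- constant `M`, a bound for `|Z''|`.
    have hf : ∀ r : ℝ, HasDerivAt (fun r : ℝ => Z (s + r) - r * deriv Z s)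
        (deriv Z (s + r) - deriv Z s) r := fun r => by
      have h1 := (h.hasDerivAt (s + r)).comp_const_add s r
      have h2 : HasDerivAt (fun r : ℝ => (r : ℂ)) 1 r := ofRealCLM.hasDerivAt
      simpa using h1.fun_sub (h2.mul_const (deriv Z s))
    have := (convex_uIcc (0 : ℝ) σ).norm_image_sub_le_of_norm_hasDerivWithin_le
      (C := M * |σ|) (fun r _ => (hf r).hasDerivWithinAt)
      (fun r hr => hd r (by
        have := abs_sub_left_of_mem_uIcc hr
        simpa using this)) left_mem_uIcc right_mem_uIcc
    simp only [add_zero, ofReal_zero, zero_mul, sub_zero, Real.norm_eq_abs] at this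
    have e : Z (s + σ) - Z s - σ * deriv Z s = Z (s + σ) - σ * deriv Z s - Z s := by ring
    rw [e]
    refine this.trans (le_of_eq ?_)
    rw [mul_assoc, ← sq, sq_abs]

end IsC2Curve

/-! ### Wirtinger calculus and differentiation of the potential. -/

/-- The real linear map `v ↦ p v + q v̄` of the complex plane. -/
noncomputable def wirtinger (p q : ℂ) : ℂ →L[ℝ] ℂ :=
  p • ContinuousLinearMap.id ℝ ℂ + q • (conjCLE : ℂ →L[ℝ] ℂ)

@[simp] lemma wirtinger_apply (p q v : ℂ) : wirtinger p q v = p * v + q * conj v := by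
  simp [wirtinger]

lemma norm_wirtinger_le (p q : ℂ) : ‖wirtinger p q‖ ≤ ‖p‖ + ‖q‖ := by
  refine ContinuousLinearMap.opNorm_le_bound _ (by positivity) fun v => ?_
  rw [wirtinger_apply, add_mul]
  refine (norm_add_le _ _).trans ?_
  rw [norm_mul, norm_mul, norm_conj]

lemma hasFDerivAt_conj_comp {g : ℂ → ℂ} {p q w : ℂ} (h : HasFDerivAt g (wirtinger p q) w) :
    HasFDerivAt (fun w => conj (g w)) (wirtinger (conj q) (conj p)) w := by
  refine ((conjCLE : ℂ →L[ℝ] ℂ).hasFDerivAt.comp w h).congr_fderiv ?_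
  ext v
  simp
  ring

lemma hasFDerivAt_inv_wirtinger {w : ℂ} (hw : w ≠ 0) :
    HasFDerivAt (fun w : ℂ => w⁻¹) (wirtinger (-(w ^ 2)⁻¹) 0) w := by
  refine ((hasDerivAt_inv hw).hasFDerivAt.restrictScalars ℝ).congr_fderiv ?_
  ext v
  simp [mul_comm]

lemma hasFDerivAt_div_conj_sq {w : ℂ} (hw : w ≠ 0) :
    HasFDerivAt (fun w : ℂ => w / conj w ^ 2)
      (wirtinger ((conj w ^ 2)⁻¹) (-2 * w * (conj w ^ 3)⁻¹)) w := by
  have hw' : conj w ≠ 0 := (map_ne_zero _).2 hw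
  have h1 := hasFDerivAt_conj_comp (hasFDerivAt_inv_wirtinger hw)
  have h2 := (hasFDerivAt_id (𝕜 := ℝ) w).mul (h1.mul h1)
  refine (h2.congr_fderiv ?_).congr_of_eventuallyEq (Eventually.of_forall fun v => ?_)
  · ext v
    simp
    field_simp
    ring_nf
  · simp [div_eq_mul_inv, sq]

/-- The integrand of the double layer potential, in complex notation. -/
noncomputable def layerKernel (A B : ℝ) (τ f w : ℂ) : ℂ :=
  A / (4 * Real.pi) * (I * τ * w⁻¹ - I * conj τ * (conj w)⁻¹) * f
    - B / (4 * Real.pi) * (I * τ * (conj w)⁻¹ + I * conj τ * (w / conj w ^ 2)) * conj f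

/-- The `∂/∂w` derivative of `layerKernel`. -/
noncomputable def layerKernelDz (A B : ℝ) (τ f w : ℂ) : ℂ :=
  -(A / (4 * Real.pi) * (I * τ * (w ^ 2)⁻¹) * f)
    - B / (4 * Real.pi) * (I * conj τ * (conj w ^ 2)⁻¹) * conj f

/-- The `∂/∂w̄` derivative of `layerKernel`. -/
noncomputable def layerKernelDzbar (A B : ℝ) (τ f w : ℂ) : ℂ :=
  A / (4 * Real.pi) * (I * conj τ * (conj w ^ 2)⁻¹) * f
    + B / (4 * Real.pi) * (I * τ * (conj w ^ 2)⁻¹ + 2 * I * conj τ * w * (conj w ^ 3)⁻¹) * conj f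

lemma hasFDerivAt_layerKernel (A B : ℝ) (τ f : ℂ) {w : ℂ} (hw : w ≠ 0) :
    HasFDerivAt (layerKernel A B τ f)
      (wirtinger (layerKernelDz A B τ f w) (layerKernelDzbar A B τ f w)) w := by
  have h1 := hasFDerivAt_inv_wirtinger hw
  have h2 : HasFDerivAt (fun w : ℂ => (conj w)⁻¹) (wirtinger 0 (-(conj w ^ 2)⁻¹)) w := by
    simpa [map_inv₀] using hasFDerivAt_conj_comp h1
  have h3 := hasFDerivAt_div_conj_sq hw
  have h := ((((h1.const_mul (I * τ)).fun_sub (h2.const_mul (I * conj τ))).const_mul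
      (A / (4 * Real.pi) : ℂ)).mul_const f).fun_sub
    ((((h2.const_mul (I * τ)).fun_add (h3.const_mul (I * conj τ))).const_mul
      (B / (4 * Real.pi) : ℂ)).mul_const (conj f))
  refine h.congr_fderiv ?_
  ext v
  simp [layerKernelDz, layerKernelDzbar]
  ring

namespace IsC2Curve

variable {L : ℝ} {Z : ℝ → ℂ}

lemma isClosed_range (h : IsC2Curve L Z) : IsClosed (range Z) := by
  have hL := h.pos
  have : range Z = Z '' Icc 0 (0 + 2 * L) := (h.periodic.image_Icc (by linarith) 0).symm
  rw [this]
  exact (isCompact_Icc.image h.contDiff.continuous).isClosed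

/-- Differentiation of the double layer potential under the integral sign. -/
lemma hasFDerivAt_potential (h : IsC2Curve L Z) (A B : ℝ) {f : ℝ → ℂ} (hf : Continuous f)
    (s₀ : ℝ) {z : ℂ} (hz : z ∉ range Z) :
    HasFDerivAt (fun z => ∫ s in (s₀ - L)..(s₀ + L), layerKernel A B (deriv Z s) (f s) (z - Z s))
      (wirtinger
        (∫ s in (s₀ - L)..(s₀ + L), layerKernelDz A B (deriv Z s) (f s) (z - Z s))
        (∫ s in (s₀ - L)..(s₀ + L), layerKernelDzbar A B (deriv Z s) (f s) (z - Z s))) z := by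
  have hL := h.pos
  have hZ := h.contDiff.continuous
  have hZ' := h.contDiff_deriv.continuous
  -- The closed ball of radius `ε/2` stays off the curve; by compactness both kernel derivatives are
  -- bounded there uniformly in `s`.
  obtain ⟨ε, hε, hball⟩ := Metric.isOpen_iff.1 h.isClosed_range.isOpen_compl z hz
  have hne : ∀ y ∈ Metric.closedBall z (ε / 2), ∀ s, y - Z s ≠ 0 := fun y hy s h0 =>
    hball (Metric.closedBall_subset_ball (by linarith) hy) ⟨s, (sub_eq_zero.1 h0).symm⟩
  have hne' : ∀ y ∈ Metric.closedBall z (ε / 2), ∀ s, conj (y - Z s) ≠ 0 := fun y hy s =>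
    (map_ne_zero _).2 (hne y hy s)
  have hcz : ContinuousOn (fun q : ℂ × ℝ => layerKernelDz A B (deriv Z q.2) (f q.2) (q.1 - Z q.2))
      (Metric.closedBall z (ε / 2) ×ˢ Icc (s₀ - L) (s₀ + L)) := by
    unfold layerKernelDz
    have i1 : ContinuousOn (fun q : ℂ × ℝ => ((q.1 - Z q.2) ^ 2)⁻¹)
        (Metric.closedBall z (ε / 2) ×ˢ Icc (s₀ - L) (s₀ + L)) :=
      ContinuousOn.inv₀ (by fun_prop) fun q hq => pow_ne_zero _ (hne _ hq.1 _)
    have i2 : ContinuousOn (fun q : ℂ × ℝ => (conj (q.1 - Z q.2) ^ 2)⁻¹)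
        (Metric.closedBall z (ε / 2) ×ˢ Icc (s₀ - L) (s₀ + L)) :=
      ContinuousOn.inv₀ (by fun_prop) fun q hq => pow_ne_zero _ (hne' _ hq.1 _)
    fun_prop
  have hczb : ContinuousOn
      (fun q : ℂ × ℝ => layerKernelDzbar A B (deriv Z q.2) (f q.2) (q.1 - Z q.2))
      (Metric.closedBall z (ε / 2) ×ˢ Icc (s₀ - L) (s₀ + L)) := by
    unfold layerKernelDzbar
    have i2 : ContinuousOn (fun q : ℂ × ℝ => (conj (q.1 - Z q.2) ^ 2)⁻¹)
        (Metric.closedBall z (ε / 2) ×ˢ Icc (s₀ - L) (s₀ + L)) :=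
      ContinuousOn.inv₀ (by fun_prop) fun q hq => pow_ne_zero _ (hne' _ hq.1 _)
    have i3 : ContinuousOn (fun q : ℂ × ℝ => (conj (q.1 - Z q.2) ^ 3)⁻¹)
        (Metric.closedBall z (ε / 2) ×ˢ Icc (s₀ - L) (s₀ + L)) :=
      ContinuousOn.inv₀ (by fun_prop) fun q hq => pow_ne_zero _ (hne' _ hq.1 _)
    fun_prop
  have hcK : ∀ y ∈ Metric.closedBall z (ε / 2),
      Continuous fun s => layerKernel A B (deriv Z s) (f s) (y - Z s) := by
    intro y hy
    unfold layerKernel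
    have i1 : Continuous fun s => (y - Z s)⁻¹ := Continuous.inv₀ (by fun_prop) (hne y hy)
    have i2 : Continuous fun s => (conj (y - Z s))⁻¹ := Continuous.inv₀ (by fun_prop) (hne' y hy)
    have i3 : Continuous fun s => (y - Z s) / conj (y - Z s) ^ 2 :=
      Continuous.div (by fun_prop) (by fun_prop) fun s => pow_ne_zero _ (hne' y hy s)
    fun_prop
  have hzb : z ∈ Metric.closedBall z (ε / 2) := Metric.mem_closedBall_self (by linarith)
  have hcz' : ContinuousOn (fun s => layerKernelDz A B (deriv Z s) (f s) (z - Z s))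
      (Icc (s₀ - L) (s₀ + L)) :=
    hcz.comp (f := fun s : ℝ => (z, s)) (by fun_prop) fun s hs => ⟨hzb, hs⟩
  have hczb' : ContinuousOn (fun s => layerKernelDzbar A B (deriv Z s) (f s) (z - Z s))
      (Icc (s₀ - L) (s₀ + L)) :=
    hczb.comp (f := fun s : ℝ => (z, s)) (by fun_prop) fun s hs => ⟨hzb, hs⟩
  have huIcc : uIcc (s₀ - L) (s₀ + L) = Icc (s₀ - L) (s₀ + L) := uIcc_of_le (by linarith)
  have hwc : ContinuousOn (fun s => wirtinger (layerKernelDz A B (deriv Z s) (f s) (z - Z s))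
      (layerKernelDzbar A B (deriv Z s) (f s) (z - Z s))) (uIcc (s₀ - L) (s₀ + L)) := by
    rw [huIcc]
    unfold wirtinger
    fun_prop
  obtain ⟨M₁, hM₁⟩ := ((isCompact_closedBall z (ε / 2)).prod isCompact_Icc
    ).exists_bound_of_continuousOn hcz
  obtain ⟨M₂, hM₂⟩ := ((isCompact_closedBall z (ε / 2)).prod isCompact_Icc
    ).exists_bound_of_continuousOn hczb
  have main := intervalIntegral.hasFDerivAt_integral_of_dominated_of_fderiv_le (𝕜 := ℝ)
    (μ := volume) (a := s₀ - L) (b := s₀ + L) (s := Metric.closedBall z (ε / 2)) (x₀ := z)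
    (F := fun y s => layerKernel A B (deriv Z s) (f s) (y - Z s))
    (F' := fun y s => wirtinger (layerKernelDz A B (deriv Z s) (f s) (y - Z s))
      (layerKernelDzbar A B (deriv Z s) (f s) (y - Z s))) (bound := fun _ => M₁ + M₂)
    (Metric.closedBall_mem_nhds z (by linarith))
    (by
      filter_upwards [Metric.closedBall_mem_nhds z (half_pos hε)] with y hy
      exact (hcK y hy).aestronglyMeasurable)
    ((hcK z hzb).intervalIntegrable _ _)
    ((hwc.mono uIoc_subset_uIcc).aestronglyMeasurable measurableSet_uIoc)
    (Eventually.of_forall fun s hs y hy => by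
      have hs' : s ∈ Icc (s₀ - L) (s₀ + L) := huIcc ▸ uIoc_subset_uIcc hs
      exact (norm_wirtinger_le _ _).trans (add_le_add (hM₁ (y, s) ⟨hy, hs'⟩) (hM₂ (y, s) ⟨hy, hs'⟩)))
    intervalIntegrable_const
    (Eventually.of_forall fun s hs y hy =>
      (hasFDerivAt_comp_sub (Z s)).2 (hasFDerivAt_layerKernel A B (deriv Z s) (f s) (hne y hy s)))
  refine main.congr_fderiv ?_
  have hI1 : IntervalIntegrable (fun s => layerKernelDz A B (deriv Z s) (f s) (z - Z s)) volume
      (s₀ - L) (s₀ + L) := (huIcc ▸ hcz').intervalIntegrable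
  have hI2 : IntervalIntegrable (fun s => layerKernelDzbar A B (deriv Z s) (f s) (z - Z s)) volume
      (s₀ - L) (s₀ + L) := (huIcc ▸ hczb').intervalIntegrable
  refine ContinuousLinearMap.ext fun v => ?_
  rw [ContinuousLinearMap.intervalIntegral_apply hwc.intervalIntegrable]
  simp only [wirtinger_apply]
  rw [intervalIntegral.integral_add (hI1.mul_const _) (hI2.mul_const _),
    intervalIntegral.integral_mul_const, intervalIntegral.integral_mul_const]

end IsC2Curve

/-! ### Integration by parts along the curve. -/

lemma hasDerivAt_conj_comp {g : ℝ → ℂ} {g' : ℂ} {s : ℝ} (h : HasDerivAt g g' s) :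
    HasDerivAt (fun s => conj (g s)) (conj g') s :=
  (conjCLE : ℂ →L[ℝ] ℂ).hasFDerivAt.comp_hasDerivAt s h

/-- Over a full period the boundary terms cancel, so `u` may be exchanged for `v` once the primitive
`G` is guessed. -/
lemma integral_eq_of_hasDerivAt_periodic {L : ℝ} {G u v : ℝ → ℂ} (s₀ : ℝ)
    (hG : ∀ s, HasDerivAt G (u s - v s) s) (hper : Function.Periodic G (2 * L))
    (hu : Continuous u) (hv : Continuous v) :
    ∫ s in (s₀ - L)..(s₀ + L), u s = ∫ s in (s₀ - L)..(s₀ + L), v s := by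
  have h1 := intervalIntegral.integral_eq_sub_of_hasDerivAt (a := s₀ - L) (b := s₀ + L)
    (fun s _ => hG s) ((hu.sub hv).intervalIntegrable _ _)
  rw [intervalIntegral.integral_sub (hu.intervalIntegrable _ _) (hv.intervalIntegrable _ _)] at h1
  have h2 := hper (s₀ - L)
  rw [show s₀ - L + 2 * L = s₀ + L by ring] at h2
  rw [h2, sub_self, sub_eq_zero] at h1
  exact h1

/-- The density `(φ̄ τ²)'` in complex notation. -/
noncomputable def twistedDeriv (Z f : ℝ → ℂ) (s : ℝ) : ℂ :=
  conj (deriv f s) * deriv Z s ^ 2 + conj (f s) * (2 * deriv Z s * deriv (deriv Z) s)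

namespace IsC2Curve

variable {L : ℝ} {Z : ℝ → ℂ}

lemma hasDerivAt_twisted (h : IsC2Curve L Z) {f : ℝ → ℂ} (hf : ContDiff ℝ 1 f) (s : ℝ) :
    HasDerivAt (fun s => conj (f s) * deriv Z s ^ 2) (twistedDeriv Z f s) s := by
  have h1 := hasDerivAt_conj_comp (hf.differentiable one_ne_zero s).hasDerivAt
  have h2 := (h.contDiff_deriv.differentiable one_ne_zero s).hasDerivAt
  refine (h1.mul (h2.pow 2)).congr_deriv ?_
  simp [twistedDeriv]

lemma continuous_twistedDeriv (h : IsC2Curve L Z) {f : ℝ → ℂ} (hf : ContDiff ℝ 1 f) :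
    Continuous (twistedDeriv Z f) := by
  have h1 := hf.continuous
  have h2 := hf.continuous_deriv le_rfl
  have h3 := h.contDiff_deriv.continuous
  have h4 := h.contDiff_deriv.continuous_deriv le_rfl
  unfold twistedDeriv
  fun_prop

lemma periodic_deriv_of {g : ℝ → ℂ} {T : ℝ} (hg : Function.Periodic g T) :
    Function.Periodic (deriv g) T := fun s => by
  rw [← deriv_comp_add_const]
  congr 1
  exact funext hg

/-- Integration by parts in the `∂/∂z` derivative of the potential. -/
lemma integral_layerKernelDz (h : IsC2Curve L Z) (A B : ℝ) {f : ℝ → ℂ} (hf : ContDiff ℝ 1 f)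
    (hper : Function.Periodic f (2 * L)) (s₀ : ℝ) {z : ℂ} (hz : z ∉ range Z) :
    ∫ s in (s₀ - L)..(s₀ + L), layerKernelDz A B (deriv Z s) (f s) (z - Z s)
      = A / (4 * Real.pi) * I * (∫ s in (s₀ - L)..(s₀ + L), deriv f s * (z - Z s)⁻¹)
        + B / (4 * Real.pi) * I * conj (∫ s in (s₀ - L)..(s₀ + L), deriv f s * (z - Z s)⁻¹) := by
  have hZ := h.contDiff.continuous
  have hZ' := h.contDiff_deriv.continuous
  have hfc := hf.continuous
  have hf' := hf.continuous_deriv le_rfl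
  have hne : ∀ s, z - Z s ≠ 0 := fun s h0 => hz ⟨s, (sub_eq_zero.1 h0).symm⟩
  have hne' : ∀ s, conj (z - Z s) ≠ 0 := fun s => (map_ne_zero _).2 (hne s)
  have i1 : Continuous fun s => (z - Z s)⁻¹ := Continuous.inv₀ (by fun_prop) hne
  have i2 : Continuous fun s => ((z - Z s) ^ 2)⁻¹ :=
    Continuous.inv₀ (by fun_prop) fun s => pow_ne_zero _ (hne s)
  have i3 : Continuous fun s => (conj (z - Z s) ^ 2)⁻¹ :=
    Continuous.inv₀ (by fun_prop) fun s => pow_ne_zero _ (hne' s)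
  have hF : Continuous fun s => deriv f s * (z - Z s)⁻¹ := by fun_prop
  -- Both terms are exact: `τ/w² = d/ds (1/w)`, and the second involves the conjugate of this.
  rw [integral_eq_of_hasDerivAt_periodic (L := L)
    (v := fun s => A / (4 * Real.pi) * I * (deriv f s * (z - Z s)⁻¹)
      + B / (4 * Real.pi) * I * conj (deriv f s * (z - Z s)⁻¹))
    (G := fun s => -(A / (4 * Real.pi) * I * (f s * (z - Z s)⁻¹)
      + B / (4 * Real.pi) * I * conj (f s * (z - Z s)⁻¹))) s₀ ?_ ?_ ?_ (by fun_prop)]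
  · rw [intervalIntegral.integral_add, intervalIntegral.integral_const_mul,
      intervalIntegral.integral_const_mul, intervalIntegral.intervalIntegral_conj]
    · exact (hF.const_mul _).intervalIntegrable _ _
    · exact Continuous.intervalIntegrable (by fun_prop) _ _
  · intro s
    have d1 := (hf.differentiable one_ne_zero s).hasDerivAt
    have d2 := ((h.hasDerivAt s).const_sub z).fun_inv (hne s)
    have d3 := d1.fun_mul d2
    have d4 := hasDerivAt_conj_comp d3
    refine (((d3.const_mul (A / (4 * Real.pi) * I : ℂ)).fun_add
      (d4.const_mul (B / (4 * Real.pi) * I : ℂ))).fun_neg).congr_deriv ?_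
    simp only [layerKernelDz, map_mul, map_add, map_div₀, map_neg, map_inv₀, map_pow]
    ring
  · intro s
    simp only [hper s, h.periodic s]
  · unfold layerKernelDz
    fun_prop

/-- Integration by parts in the `∂/∂z̄` derivative of the potential. -/
lemma integral_layerKernelDzbar (h : IsC2Curve L Z) (A B : ℝ) {f : ℝ → ℂ} (hf : ContDiff ℝ 1 f)
    (hper : Function.Periodic f (2 * L)) (s₀ : ℝ) {z : ℂ} (hz : z ∉ range Z) :
    ∫ s in (s₀ - L)..(s₀ + L), layerKernelDzbar A B (deriv Z s) (f s) (z - Z s)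
      = -(A / (4 * Real.pi) * I * ∫ s in (s₀ - L)..(s₀ + L), deriv f s * (conj (z - Z s))⁻¹)
        - B / (4 * Real.pi) * I *
          ((∫ s in (s₀ - L)..(s₀ + L), conj (deriv f s) * ((z - Z s) / conj (z - Z s) ^ 2))
            + 2 * ∫ s in (s₀ - L)..(s₀ + L), twistedDeriv Z f s * (conj (z - Z s))⁻¹) := by
  have hZ := h.contDiff.continuous
  have hZ' := h.contDiff_deriv.continuous
  have hfc := hf.continuous
  have hf' := hf.continuous_deriv le_rfl
  have hm := h.continuous_twistedDeriv hf
  have hne : ∀ s, z - Z s ≠ 0 := fun s h0 => hz ⟨s, (sub_eq_zero.1 h0).symm⟩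
  have hne' : ∀ s, conj (z - Z s) ≠ 0 := fun s => (map_ne_zero _).2 (hne s)
  have i1 : Continuous fun s => (conj (z - Z s))⁻¹ := Continuous.inv₀ (by fun_prop) hne'
  have i2 : Continuous fun s => (conj (z - Z s) ^ 2)⁻¹ :=
    Continuous.inv₀ (by fun_prop) fun s => pow_ne_zero _ (hne' s)
  have i3 : Continuous fun s => (conj (z - Z s) ^ 3)⁻¹ :=
    Continuous.inv₀ (by fun_prop) fun s => pow_ne_zero _ (hne' s)
  have i4 : Continuous fun s => (z - Z s) / conj (z - Z s) ^ 2 :=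
    Continuous.div (by fun_prop) (by fun_prop) fun s => pow_ne_zero _ (hne' s)
  have c1 : Continuous fun s => deriv f s * (conj (z - Z s))⁻¹ := by fun_prop
  have c2 : Continuous fun s => conj (deriv f s) * ((z - Z s) / conj (z - Z s) ^ 2) := by fun_prop
  have c3 : Continuous fun s => twistedDeriv Z f s * (conj (z - Z s))⁻¹ := by fun_prop
  -- The factor of `f̄` satisfies `τ/w̄² + 2τ̄w/w̄³ = d/ds (w/w̄²) + 2τ/w̄²`, and `τ τ̄ = 1` gives
  -- `τ/w̄² = τ² d/ds (1/w̄)`. This is the source of the density `(f̄ τ²)'`.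
  rw [integral_eq_of_hasDerivAt_periodic (L := L)
    (v := fun s => -(A / (4 * Real.pi) * I * (deriv f s * (conj (z - Z s))⁻¹))
      - B / (4 * Real.pi) * I * (conj (deriv f s) * ((z - Z s) / conj (z - Z s) ^ 2)
        + 2 * (twistedDeriv Z f s * (conj (z - Z s))⁻¹)))
    (G := fun s => A / (4 * Real.pi) * I * (f s * (conj (z - Z s))⁻¹)
      + B / (4 * Real.pi) * I * (conj (f s) * ((z - Z s) * ((conj (z - Z s))⁻¹ * (conj (z - Z s))⁻¹))
        + 2 * ((conj (f s) * deriv Z s ^ 2) * (conj (z - Z s))⁻¹))) s₀ ?_ ?_ ?_ (by fun_prop)]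
  · rw [intervalIntegral.integral_sub, intervalIntegral.integral_neg,
      intervalIntegral.integral_const_mul, intervalIntegral.integral_const_mul,
      intervalIntegral.integral_add, intervalIntegral.integral_const_mul]
    all_goals exact Continuous.intervalIntegrable (by fun_prop) _ _
  · intro s
    have d1 := (hf.differentiable one_ne_zero s).hasDerivAt
    have d2 := (h.hasDerivAt s).const_sub z
    have d3 := (hasDerivAt_conj_comp d2).fun_inv (hne' s)
    have d4 := d1.fun_mul d3
    have d5 := (hasDerivAt_conj_comp d1).fun_mul (d2.fun_mul (d3.fun_mul d3))
    have d6 := (h.hasDerivAt_twisted hf s).fun_mul d3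
    refine ((d4.const_mul (A / (4 * Real.pi) * I : ℂ)).fun_add
      ((d5.fun_add (d6.const_mul 2)).const_mul (B / (4 * Real.pi) * I : ℂ))).congr_deriv ?_
    have e1 : deriv Z s * conj (deriv Z s) = 1 := mul_conj_eq_one (h.unit_speed s)
    have n1 := hne' s
    simp only [layerKernelDzbar, map_neg]
    generalize conj (z - Z s) = wb at n1 ⊢
    generalize z - Z s = w at ⊢
    generalize conj (deriv Z s) = tb at e1 ⊢
    field_simp
    linear_combination (2 * B * conj (f s) * deriv Z s * wb) * e1
  · intro s
    simp only [hper s, h.periodic s, periodic_deriv_of h.periodic s]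
  · unfold layerKernelDzbar
    fun_prop

end IsC2Curve

/-! ### The conormal derivative and the Kelvin matrix in complex notation. -/

/-- The identification of the Euclidean plane with the complex plane. -/
noncomputable def toComplex : Plane ≃ₗᵢ[ℝ] ℂ := Complex.orthonormalBasisOneI.repr.symm

lemma toComplex_apply (v : Plane) : toComplex v = v 0 + v 1 * I := by
  simp [toComplex, ← Complex.orthonormalBasisOneI.sum_repr_symm, Fin.sum_univ_two]

lemma toComplex_symm_zero (z : ℂ) : toComplex.symm z 0 = z.re := by
  simp [toComplex]

lemma toComplex_symm_one (z : ℂ) : toComplex.symm z 1 = z.im := by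
  simp [toComplex]

lemma toComplex_rotNeg (v : Plane) : toComplex (rotNeg v) = -I * toComplex v := by
  simp only [toComplex_apply, rotNeg]
  simp
  ring_nf
  rw [I_sq]
  ring

lemma inner_eq_re (v w : Plane) : ⟪v, w⟫ = (toComplex v * conj (toComplex w)).re := by
  rw [← toComplex.inner_map_map, Complex.inner, ← Complex.conj_re]
  simp [mul_comm]

/-- The real linear operator of the plane given by `v ↦ p v + q v̄` in complex notation. -/
noncomputable def planeWirtinger (p q : ℂ) : Plane →L[ℝ] Plane :=
  (toComplex.symm.toContinuousLinearEquiv : ℂ →L[ℝ] Plane) ∘L wirtinger p q ∘L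
    (toComplex.toContinuousLinearEquiv : Plane →L[ℝ] ℂ)

lemma planeWirtinger_apply (p q : ℂ) (v : Plane) : planeWirtinger p q v
    = toComplex.symm (p * toComplex v + q * conj (toComplex v)) := by
  simp [planeWirtinger]

lemma adjoint_planeWirtinger (p q : ℂ) :
    ContinuousLinearMap.adjoint (planeWirtinger p q) = planeWirtinger (conj p) q := by
  symm
  rw [ContinuousLinearMap.eq_adjoint_iff]
  intro v w
  rw [inner_eq_re, inner_eq_re, planeWirtinger_apply, planeWirtinger_apply,
    LinearIsometryEquiv.apply_symm_apply, LinearIsometryEquiv.apply_symm_apply]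
  simp
  ring

/-- Transposition conjugates `p = ∂_z u` and keeps `q = ∂_z̄ u`, so the symmetric gradient and the
divergence see only `Re p` and `q`. -/
lemma toComplex_conormal (lam mu : ℝ) {u : Plane → Plane} {x : Plane} {p q : ℂ}
    (hu : HasFDerivAt u (planeWirtinger p q) x) (n : Plane) :
    toComplex (conormal lam mu u n x)
      = 2 * (lam + mu) * (p.re : ℂ) * toComplex n + 2 * mu * q * conj (toComplex n) := by
  have hdiv : divergence u x = 2 * p.re := by
    simp only [divergence, hu.fderiv, Fin.sum_univ_two, planeWirtinger_apply, toComplex_symm_zero,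
      toComplex_symm_one, toComplex_apply]
    simp
    ring
  rw [conormal, hdiv, hu.fderiv, adjoint_planeWirtinger, planeWirtinger_apply, planeWirtinger_apply]
  simp only [map_add, map_smul, LinearIsometryEquiv.apply_symm_apply, Complex.real_smul]
  have h2 : conj p = 2 * (p.re : ℂ) - p := by
    apply Complex.ext
    · simp; ring
    · simp
  rw [h2]
  push_cast
  ring

lemma differentiableAt_kelvin (lam mu : ℝ) {x : Plane} (hx : x ≠ 0) :
    DifferentiableAt ℝ (kelvin lam mu) x := by
  have hn : DifferentiableAt ℝ (fun x : Plane => ‖x‖) x := differentiableAt_id.norm ℝ hx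
  have hx' : ‖x‖ ≠ 0 := norm_ne_zero_iff.2 hx
  have h1 : DifferentiableAt ℝ (fun x : Plane => Real.log ‖x‖) x := hn.log hx'
  have h2 : DifferentiableAt ℝ (fun x : Plane => tensor x x) x := by
    let ℓ : Plane →ₗ[ℝ] (Plane →L[ℝ] ℝ) :=
      { toFun := fun x => innerSL ℝ x
        map_add' := fun x y => by simp
        map_smul' := fun c x => by simp }
    have hℓ : DifferentiableAt ℝ (fun x : Plane => innerSL ℝ x) x :=
      (LinearMap.toContinuousLinearMap ℓ).differentiableAt
    unfold tensor
    fun_prop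
  have h4 : DifferentiableAt ℝ (fun x : Plane => ‖x‖ ^ 2) x := hn.fun_pow 2
  have h3 : DifferentiableAt ℝ
      (fun x : Plane => constB lam mu / (2 * Real.pi) / ‖x‖ ^ 2) x := by
    simp only [div_eq_mul_inv]
    exact (h4.fun_inv (pow_ne_zero _ hx')).const_mul _
  unfold kelvin
  exact ((h1.const_mul _).smul (differentiableAt_const _)).sub (h3.smul h2)

/-- The Kelvin matrix in complex notation. -/
noncomputable def kelvinC (A B : ℝ) (f z : ℂ) : ℂ :=
  A / (2 * Real.pi) * (Real.log ‖z‖ : ℝ) * f - B / (4 * Real.pi) * (f + conj f * (z * (conj z)⁻¹))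

lemma toComplex_kelvin (lam mu : ℝ) {x : Plane} (hx : x ≠ 0) (v : Plane) :
    toComplex (kelvin lam mu x v)
      = kelvinC (constA lam mu) (constB lam mu) (toComplex v) (toComplex x) := by
  have hz : toComplex x ≠ 0 := by simpa using hx
  have hz' : conj (toComplex x) ≠ 0 := (map_ne_zero _).2 hz
  have hin : ((⟪x, v⟫ : ℝ) : ℂ)
      = (toComplex x * conj (toComplex v) + conj (toComplex x) * toComplex v) / 2 := by
    rw [inner_eq_re, Complex.re_eq_add_conj]
    simp
  have hnorm : ((‖x‖ : ℝ) : ℂ) ^ 2 = toComplex x * conj (toComplex x) := by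
    rw [← toComplex.norm_map, mul_conj, normSq_eq_norm_sq]
    push_cast
    rfl
  simp only [kelvin, kelvinC, tensor, _root_.sub_apply, _root_.smul_apply,
    ContinuousLinearMap.smulRight_apply, innerSL_apply_apply, ContinuousLinearMap.id_apply,
    map_sub, map_smul, Complex.real_smul, toComplex.norm_map]
  rw [hin]
  push_cast
  rw [hnorm]
  field_simp
  ring

lemma hasFDerivAt_log_norm {z : ℂ} (hz : z ≠ 0) :
    HasFDerivAt (fun z : ℂ => ((Real.log ‖z‖ : ℝ) : ℂ))
      (wirtinger (z⁻¹ / 2) ((conj z)⁻¹ / 2)) z := by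
  have hz' : conj z ≠ 0 := (map_ne_zero _).2 hz
  have hn : ‖z‖ ^ 2 ≠ 0 := pow_ne_zero _ (norm_ne_zero_iff.2 hz)
  have h1 := ((hasStrictFDerivAt_norm_sq z).hasFDerivAt.log hn).const_mul (1 / 2 : ℝ)
  have h2 := ofRealCLM.hasFDerivAt.comp z h1
  refine (h2.congr_fderiv ?_).congr_of_eventuallyEq (Eventually.of_forall fun w => ?_)
  · refine ContinuousLinearMap.ext fun v => ?_
    have hin : ((⟪z, v⟫ : ℝ) : ℂ) = (z * conj v + conj z * v) / 2 := by
      rw [Complex.inner, Complex.re_eq_add_conj]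
      simp
      ring
    have hnorm : ((‖z‖ : ℝ) : ℂ) ^ 2 = z * conj z := by
      rw [mul_conj, normSq_eq_norm_sq]
      push_cast
      rfl
    have he : (((1 / 2 : ℝ) • (‖z‖ ^ 2)⁻¹ • 2 • (innerSL ℝ z)) v) = (‖z‖ ^ 2)⁻¹ * ⟪z, v⟫ := by
      simp [-Complex.inner]
      ring
    rw [ContinuousLinearMap.comp_apply, he, wirtinger_apply, ofRealCLM_apply]
    push_cast
    rw [hin, hnorm]
    field_simp
    ring
  · simp [Real.log_pow]

lemma hasFDerivAt_kelvinC (A B : ℝ) (f : ℂ) {z : ℂ} (hz : z ≠ 0) :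
    HasFDerivAt (kelvinC A B f) (wirtinger
      (A / (4 * Real.pi) * z⁻¹ * f - B / (4 * Real.pi) * (conj z)⁻¹ * conj f)
      (A / (4 * Real.pi) * (conj z)⁻¹ * f + B / (4 * Real.pi) * (z / conj z ^ 2) * conj f)) z := by
  have h1 := hasFDerivAt_log_norm hz
  have h2 : HasFDerivAt (fun w : ℂ => (conj w)⁻¹) (wirtinger 0 (-(conj z ^ 2)⁻¹)) z := by
    simpa [map_inv₀] using hasFDerivAt_conj_comp (hasFDerivAt_inv_wirtinger hz)
  have h3 := (hasFDerivAt_id (𝕜 := ℝ) z).fun_mul h2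
  have h := ((h1.const_mul (A / (2 * Real.pi) : ℂ)).mul_const f).fun_sub
    (((h3.const_mul (conj f)).const_add f).const_mul (B / (4 * Real.pi) : ℂ))
  refine h.congr_fderiv ?_
  refine ContinuousLinearMap.ext fun v => ?_
  simp
  ring

/-- The kernel of the double layer potential in complex notation. -/
lemma toComplex_lineDeriv_kelvin (lam mu : ℝ) {x y : Plane} (hxy : x ≠ y) (τ v : Plane) :
    toComplex ((lineDeriv ℝ (fun y => kelvin lam mu (x - y)) y (rotNeg τ)) v)
      = layerKernel (constA lam mu) (constB lam mu) (toComplex τ) (toComplex v)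
        (toComplex x - toComplex y) := by
  have hne : x - y ≠ 0 := sub_ne_zero.2 hxy
  have hz : toComplex x - toComplex y ≠ 0 := by
    rw [← map_sub]
    exact (map_ne_zero_iff _ toComplex.injective).2 hne
  have hd : DifferentiableAt ℝ (fun y => kelvin lam mu (x - y)) y :=
    DifferentiableAt.comp y (g := kelvin lam mu) (differentiableAt_kelvin lam mu hne)
      (by fun_prop)
  have h1 : HasDerivAt (fun t : ℝ => kelvin lam mu (x - (y + t • rotNeg τ)))
      (lineDeriv ℝ (fun y => kelvin lam mu (x - y)) y (rotNeg τ)) 0 :=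
    hd.lineDifferentiableAt.hasLineDerivAt
  have h2 := (toComplex.toContinuousLinearEquiv : Plane →L[ℝ] ℂ).hasFDerivAt.comp_hasDerivAt
    (0 : ℝ) (h1.clm_apply (hasDerivAt_const (0 : ℝ) v))
  have h3 : HasDerivAt (fun t : ℝ => toComplex x - (toComplex y + t * (-I * toComplex τ)))
      (-(-I * toComplex τ)) 0 := by
    have : HasDerivAt (fun t : ℝ => (t : ℂ)) 1 0 := ofRealCLM.hasDerivAt
    simpa using ((this.mul_const (-I * toComplex τ)).const_add (toComplex y)).const_sub (toComplex x)
  have h4 := HasFDerivAt.comp_hasDerivAt (0 : ℝ) (f := fun t : ℝ =>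
    toComplex x - (toComplex y + t * (-I * toComplex τ)))
    (by
      have := hasFDerivAt_kelvinC (constA lam mu) (constB lam mu) (toComplex v) hz
      simpa using this) h3
  -- The real and complex forms of the kernel agree along the line near `t = 0`, so their
  -- derivatives coincide. Moving `y` along `n` moves `x - y` with velocity `-n = iτ`.
  have h5 := h2.congr_of_eventuallyEq (f₁ := kelvinC (constA lam mu) (constB lam mu) (toComplex v) ∘
    fun t : ℝ => toComplex x - (toComplex y + t * (-I * toComplex τ))) (by
      have hc : Continuous fun t : ℝ => x - (y + t • rotNeg τ) := by fun_prop
      have hev : ∀ᶠ t : ℝ in 𝓝 0, x - (y + t • rotNeg τ) ≠ 0 :=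
        hc.continuousAt.eventually_ne (by simpa using hne)
      filter_upwards [hev] with t ht
      simp only [Function.comp_apply]
      have := toComplex_kelvin lam mu ht v
      simp only [map_sub, map_add, map_smul, toComplex_rotNeg, Complex.real_smul] at this
      exact this.symm)
  have h6 := h5.unique h4
  simp at h6
  rw [h6, layerKernel, map_sub]
  ring

/-! ### Traction along a normal line: jump and one-sided limits. -/

/-- The layer potential on the curve `Z` with kernel `K` and density `g`, at the point of the normal
line at `Z s` with parameter `t`. -/
noncomputable def layerAlong (L : ℝ) (Z : ℝ → ℂ) (K : ℂ → ℂ) (g : ℝ → ℂ) (s t : ℝ) : ℂ :=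
  ∫ σ in -L..L, g (s + σ) * K (t * (-I * deriv Z s) - (Z (s + σ) - Z s))

/-- The conormal derivative of the double layer potential along the normal line at `Z s`, in complex
notation. -/
noncomputable def tractionAlong (lam mu A B L : ℝ) (Z f : ℝ → ℂ) (s t : ℝ) : ℂ :=
  -((lam + mu) * (A - B) / (2 * Real.pi)
      * ((layerAlong L Z (fun w => w⁻¹) (deriv f) s t).im : ℂ) * (-I * deriv Z s))
    + 2 * mu * (-(A / (4 * Real.pi) * I * layerAlong L Z (fun w => (conj w)⁻¹) (deriv f) s t)
      - B / (4 * Real.pi) * I *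
        (layerAlong L Z (fun w => w / conj w ^ 2) (fun r => conj (deriv f r)) s t
          + 2 * layerAlong L Z (fun w => (conj w)⁻¹) (twistedDeriv Z f) s t))
      * conj (-I * deriv Z s)

namespace IsC2Curve

variable {L : ℝ} {Z : ℝ → ℂ} {K : ℂ → ℂ} {C : ℝ} {g : ℝ → ℂ}

lemma tendsto_layerAlong_sub (h : IsC2Curve L Z) (hK : IsOddKernel K C) (hg : Continuous g)
    (s : ℝ) : Tendsto (fun t => layerAlong L Z K g s t - layerAlong L Z K g s (-t)) (𝓝[>] 0)
      (𝓝 (g s * ∫ r : ℝ, (K ((-I * deriv Z s) - r * deriv Z s)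
        - K (-(-I * deriv Z s) - r * deriv Z s)))) := by
  have hg' : Continuous fun σ => g (s + σ) := by fun_prop
  have h1 := (h.isArc s).tendsto_jump hK hg'
  simp only [add_zero] at h1
  refine h1.congr' ?_
  filter_upwards [(h.isArc s).intervalIntegrable_mul_kernel hK hg'] with t ht
  simp only [mul_sub]
  rw [intervalIntegral.integral_sub (by simpa only [mul_sub] using ht.1)
    (by simpa only [mul_sub] using ht.2)]
  simp only [layerAlong]

lemma exists_tendsto_layerAlong (h : IsC2Curve L Z) (hK : IsOddKernel K C) (hg : Continuous g)
    {s : ℝ} (hd : IsDiniAt L g s) :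
    ∃ l, Tendsto (layerAlong L Z K g s) (𝓝[>] 0) (𝓝 l) :=
  (h.isArc s).exists_tendsto_of_dini hK (g := fun σ => g (s + σ)) (by fun_prop)
    (by simpa only [add_zero, IsDiniAt] using hd)

/-- The kernel `1/w̄` suffices: it is the only one that meets the merely continuous density
`twistedDeriv`. -/
lemma ae_exists_tendsto_layerAlong (h : IsC2Curve L Z) (hg : Continuous g)
    (hper : Function.Periodic g (2 * L)) :
    ∀ᵐ s, ∃ l, Tendsto (layerAlong L Z (fun w => (conj w)⁻¹) g s) (𝓝[>] 0) (𝓝 l) := by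
  have hc : Continuous fun r => conj (g r) := by fun_prop
  filter_upwards [ae_exists_tendsto_cauchy h.pos hc (fun r => by rw [hper r])] with s hs
  exact (h.isArc s).exists_tendsto_conj_cauchy (g := fun σ => g (s + σ)) (by fun_prop) hs

/-- The jump of the conormal derivative, in complex notation. -/
lemma tendsto_tractionAlong_sub (h : IsC2Curve L Z) {lam mu : ℝ} (hmu : 0 < mu)
    (hlam : 0 < lam + mu) {f : ℝ → ℂ} (hf : ContDiff ℝ 1 f) (s : ℝ) :
    Tendsto (fun t => tractionAlong lam mu (constA lam mu) (constB lam mu) L Z f s t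
        - tractionAlong lam mu (constA lam mu) (constB lam mu) L Z f s (-t)) (𝓝[>] 0)
      (𝓝 (-(I / 2) * ((1 - lam / (2 * mu + lam)) * deriv f s
        + (1 + lam / (2 * mu + lam)) * twistedDeriv Z f s))) := by
  have hτ := h.unit_speed s
  have hf' := hf.continuous_deriv le_rfl
  have hcf' : Continuous fun r => conj (deriv f r) := by fun_prop
  have j1 := h.tendsto_layerAlong_sub isOddKernel_inv hf' s
  have j2 := h.tendsto_layerAlong_sub isOddKernel_conj_inv hf' s
  have j3 := h.tendsto_layerAlong_sub isOddKernel_div_conj_sq hcf' s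
  have j4 := h.tendsto_layerAlong_sub isOddKernel_conj_inv (h.continuous_twistedDeriv hf) s
  rw [integral_jump_inv hτ] at j1
  rw [integral_jump_conj_inv hτ] at j2 j4
  rw [integral_jump_div_conj_sq hτ] at j3
  have j1' := ((continuous_ofReal.comp continuous_im).tendsto _).comp j1
  set A := constA lam mu with hA
  set B := constB lam mu with hB
  set τ := deriv Z s with hτd
  have key := (((j1'.const_mul ((lam + mu) * (A - B) / (2 * Real.pi) : ℂ)).mul_const
      (-I * τ)).neg).add
    (((((j2.const_mul (A / (4 * Real.pi) * I : ℂ)).neg).sub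
      ((j3.add (j4.const_mul 2)).const_mul (B / (4 * Real.pi) * I : ℂ))).const_mul
        (2 * mu : ℂ)).mul_const (conj (-I * τ)))
  have e1 : τ * conj τ = 1 := mul_conj_eq_one hτ
  refine Tendsto.congr (fun t => ?_) (key.trans (le_of_eq (congrArg 𝓝 ?_)))
  · simp only [Function.comp_apply, sub_im, ofReal_sub, tractionAlong]
    ring
  · have hpi : (Real.pi : ℂ) ≠ 0 := by exact_mod_cast Real.pi_ne_zero
    have hm : (mu : ℂ) ≠ 0 := by exact_mod_cast hmu.ne'
    have hl : (2 * mu + lam : ℂ) ≠ 0 := by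
      have : (2 * mu + lam : ℝ) ≠ 0 := by linarith
      exact_mod_cast this
    have him : ((((deriv f s * (2 * Real.pi * I * conj τ)).im : ℝ)) : ℂ)
        = Real.pi * (deriv f s * conj τ + conj (deriv f s) * τ) := by
      rw [Complex.im_eq_sub_conj]
      simp only [map_mul, conj_I, conj_ofReal, conj_conj, map_ofNat]
      field_simp
      ring
    have eA : (A : ℂ) = 1 / 2 * (1 / mu + 1 / (2 * mu + lam)) := by
      rw [hA, constA]; push_cast; rfl
    have eB : (B : ℂ) = 1 / 2 * (1 / mu - 1 / (2 * mu + lam)) := by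
      rw [hB, constB]; push_cast; rfl
    simp only [Function.comp_apply]
    simp only [map_mul, map_neg, conj_I]
    rw [him]
    have p1 : (Real.pi : ℂ) * (Real.pi : ℂ)⁻¹ = 1 := mul_inv_cancel₀ hpi
    generalize deriv f s = d at *
    generalize twistedDeriv Z f s = m at *
    generalize conj τ = tc at *
    generalize conj d = dc at *
    -- Here `d`, `dc`, `m` stand for `f'`, its conjugate and the twisted density. The terms in `dc *
    -- τ²` cancel because `(λ+μ)(A-B)/2 = μB`.
    trans I * (lam + mu) * (A - B) / 2 * (d + dc * τ ^ 2) - I * mu * A * d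
      - I * mu * B * τ ^ 2 * dc - 2 * I * mu * B * m
    · linear_combination (I * (lam + mu) * (A - B) / 2 * (d * tc + dc * τ) * τ
          + mu * tc * I ^ 3 * (A * τ * d + B * τ ^ 3 * dc + 2 * B * τ * m)) * p1
        + (I * (lam + mu) * (A - B) / 2 * d - I * mu * A * d - I * mu * B * τ ^ 2 * dc
          - 2 * I * mu * B * m) * e1
        + mu * I * τ * tc * (A * d + B * τ ^ 2 * dc + 2 * B * m) * I_sq
    · rw [eA, eB]
      have hlm : (lam : ℂ) = (2 * mu + lam) - 2 * mu := by ring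
      generalize (2 * mu + lam : ℂ) = q at hl hlm ⊢
      rw [hlm]
      field_simp
      ring

/-- Isolates as `hm` the one potential whose density involves `Z''`; the others need only `f'` to be
Dini continuous. -/
lemma exists_tendsto_tractionAlong (h : IsC2Curve L Z) (lam mu A B : ℝ) {f : ℝ → ℂ}
    (hf : ContDiff ℝ 1 f) {s : ℝ} (hd : IsDiniAt L (deriv f) s)
    (hm : ∃ l, Tendsto (layerAlong L Z (fun w => (conj w)⁻¹) (twistedDeriv Z f) s)
      (𝓝[>] 0) (𝓝 l)) :
    ∃ l, Tendsto (tractionAlong lam mu A B L Z f s) (𝓝[>] 0) (𝓝 l) := by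
  have hf' := hf.continuous_deriv le_rfl
  have hcf' : Continuous fun r => conj (deriv f r) := by fun_prop
  obtain ⟨l₁, h₁⟩ := h.exists_tendsto_layerAlong isOddKernel_inv hf' hd
  obtain ⟨l₂, h₂⟩ := h.exists_tendsto_layerAlong isOddKernel_conj_inv hf' hd
  obtain ⟨l₃, h₃⟩ := h.exists_tendsto_layerAlong isOddKernel_div_conj_sq hcf' hd.conjugate
  obtain ⟨l₄, h₄⟩ := hm
  have h₁' := ((continuous_ofReal.comp continuous_im).tendsto _).comp h₁
  exact ⟨_, (((h₁'.const_mul ((lam + mu) * (A - B) / (2 * Real.pi) : ℂ)).mul_const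
      (-I * deriv Z s)).neg).add
    (((((h₂.const_mul (A / (4 * Real.pi) * I : ℂ)).neg).sub
      ((h₃.add (h₄.const_mul 2)).const_mul (B / (4 * Real.pi) * I : ℂ))).const_mul
        (2 * mu : ℂ)).mul_const (conj (-I * deriv Z s)))⟩

lemma isDiniAt_twistedDeriv (h : IsC2Curve L Z) {f : ℝ → ℂ} (hf : ContDiff ℝ 1 f) {s : ℝ}
    (hd : IsDiniAt L (deriv f) s) (hZ : IsDiniAt L (deriv (deriv Z)) s) :
    IsDiniAt L (twistedDeriv Z f) s := by
  have h1 := hf.continuous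
  have h2 := hf.continuous_deriv le_rfl
  have h3 := h.contDiff_deriv.continuous
  have h4 := h.contDiff_deriv.continuous_deriv le_rfl
  have d1 : IsDiniAt L f s := IsDiniAt.of_contDiff h.pos hf
  have d2 : IsDiniAt L (fun r => deriv Z r ^ 2) s :=
    IsDiniAt.of_contDiff h.pos (h.contDiff_deriv.pow 2)
  have d3 : IsDiniAt L (fun r => 2 * deriv Z r) s :=
    IsDiniAt.of_contDiff h.pos (contDiff_const.mul h.contDiff_deriv)
  exact IsDiniAt.add (by fun_prop) (by fun_prop)
    (IsDiniAt.mul (by fun_prop) (by fun_prop) hd.conjugate d2)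
    (IsDiniAt.mul (by fun_prop) (by fun_prop) d1.conjugate
      (IsDiniAt.mul (by fun_prop) h4 d3 hZ))

lemma periodic_twistedDeriv (h : IsC2Curve L Z) {f : ℝ → ℂ}
    (hper : Function.Periodic f (2 * L)) : Function.Periodic (twistedDeriv Z f) (2 * L) := fun r => by
  simp only [twistedDeriv, hper r, periodic_deriv_of hper r, periodic_deriv_of h.periodic r,
    periodic_deriv_of (periodic_deriv_of h.periodic) r]

/-- The arc `[s - L, s + L]` is the whole closed curve, so `exists_lower_bound` controls the
distance to all of it. -/
lemma eventually_normal_notMem_range (h : IsC2Curve L Z) (s : ℝ) : ∀ᶠ t : ℝ in 𝓝[>] 0,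
    Z s + t * (-I * deriv Z s) ∉ range Z ∧ Z s + (-t : ℝ) * (-I * deriv Z s) ∉ range Z := by
  have hL := h.pos
  obtain ⟨c, t₀, hc, ht₀, hlow⟩ := (h.isArc s).exists_lower_bound
  have main : ∀ t : ℝ, t ≠ 0 → |t| ≤ t₀ → Z s + t * (-I * deriv Z s) ∉ range Z := by
    intro t ht ht'
    rw [← h.periodic.image_Icc (by linarith) (s - L)]
    rintro ⟨r, hr, hr'⟩
    have h1 := hlow t (r - s) ht' (abs_le.2 ⟨by linarith [hr.1], by linarith [hr.2]⟩)
    have h2 := abs_pos.2 ht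
    have h3 : 0 < c * (|t| + |r - s|) := by positivity
    rw [add_sub_cancel, hr'] at h1
    simp at h1
    linarith
  filter_upwards [Ioc_mem_nhdsGT ht₀] with t ht
  have hta : |t| = t := abs_of_pos ht.1
  exact ⟨main t ht.1.ne' (hta.trans_le ht.2),
    main (-t) (neg_ne_zero.2 ht.1.ne') (by rw [abs_neg]; exact hta.trans_le ht.2)⟩

lemma integral_eq_layerAlong (K : ℂ → ℂ) (g : ℝ → ℂ) (s t : ℝ) :
    ∫ r in (s - L)..(s + L), g r * K (Z s + t * (-I * deriv Z s) - Z r)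
      = layerAlong L Z K g s t := by
  have h1 := intervalIntegral.integral_comp_add_left (a := -L) (b := L)
    (fun r => g r * K (Z s + t * (-I * deriv Z s) - Z r)) s
  rw [← sub_eq_add_neg] at h1
  rw [← h1, layerAlong]
  congr 1
  funext σ
  congr 2
  ring

end IsC2Curve

/-! ### Return to the plane and assembly. -/

section Plane

variable {lam mu a b : ℝ} {X : ℝ → Plane} {D : Set Plane} {φ : Plane → Plane}

lemma deriv_toComplex_comp {g : ℝ → Plane} (hg : Differentiable ℝ g) :
    deriv (fun s => toComplex (g s)) = fun s => toComplex (deriv g s) := by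
  funext s
  exact ((toComplex.toContinuousLinearEquiv : Plane →L[ℝ] ℂ).hasFDerivAt.comp_hasDerivAt s
    (hg s).hasDerivAt).deriv

/-- Injectivity on `[a, b)` forces two parameters of the same point to differ by a multiple of `b -
a`, and a nonzero one exceeds the half-period. -/
lemma IsC2Domain.isC2Curve (hD : IsC2Domain D a b X) :
    IsC2Curve ((b - a) / 2) fun s => toComplex (X s) where
  pos := by
    have := hD.lt
    linarith
  contDiff := toComplex.contDiff.comp hD.contDiff
  periodic s := by
    have h1 : s + 2 * ((b - a) / 2) = s + (b - a) := by ring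
    simp only [h1, hD.periodic s]
  unit_speed s := by
    rw [deriv_toComplex_comp (hD.contDiff.differentiable two_ne_zero), toComplex.norm_map,
      hD.unit_speed]
  simple s σ hσ hσ' := by
    intro he
    have hlt := hD.lt
    have hp : 0 < b - a := by linarith
    have he' : X (s + σ) = X s := toComplex.injective he
    have hab : a + (b - a) = b := by ring
    have m1 := toIcoMod_mem_Ico hp a (s + σ)
    have m2 := toIcoMod_mem_Ico hp a s
    rw [hab] at m1 m2
    have e1 : X (toIcoMod hp a (s + σ)) = X (s + σ) := by
      rw [toIcoMod, hD.periodic.sub_zsmul_eq]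
    have e2 : X (toIcoMod hp a s) = X s := by
      rw [toIcoMod, hD.periodic.sub_zsmul_eq]
    have e3 := hD.injOn m1 m2 (by rw [e1, e2, he'])
    simp only [toIcoMod, zsmul_eq_mul] at e3
    have e4 : σ = ((toIcoDiv hp a (s + σ) - toIcoDiv hp a s : ℤ) : ℝ) * (b - a) := by
      push_cast
      linarith
    generalize toIcoDiv hp a (s + σ) - toIcoDiv hp a s = n at e4
    have hn : n ≠ 0 := by
      rintro rfl
      simp at e4
      exact hσ e4
    have hn' : (1 : ℝ) ≤ |(n : ℝ)| := by exact_mod_cast Int.one_le_abs hn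
    rw [e4, abs_mul, abs_of_pos hp] at hσ'
    nlinarith

/-- The double layer potential in complex notation. -/
lemma IsC2Domain.doubleLayerSharp_eq (hD : IsC2Domain D a b X) (s₀ : ℝ) {x : Plane}
    (hx : x ∉ range X) :
    doubleLayerSharp lam mu a b X φ x = toComplex.symm
      (∫ s in (s₀ - (b - a) / 2)..(s₀ + (b - a) / 2), layerKernel (constA lam mu) (constB lam mu)
        (deriv (fun s => toComplex (X s)) s) (toComplex (φ (X s)))
        (toComplex x - toComplex (X s))) := by
  rw [LinearIsometryEquiv.eq_symm_apply]
  have h1 : toComplex (doubleLayerSharp lam mu a b X φ x)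
      = ∫ s in a..b, toComplex ((lineDeriv ℝ (fun y => kelvin lam mu (x - y)) (X s) (normal X s))
        (φ (X s))) := by
    rw [doubleLayerSharp, intervalIntegral.integral_of_le hD.lt.le,
      intervalIntegral.integral_of_le hD.lt.le]
    exact (toComplex.toContinuousLinearEquiv.integral_comp_comm _).symm
  have h2 : ∀ s, toComplex ((lineDeriv ℝ (fun y => kelvin lam mu (x - y)) (X s) (normal X s))
      (φ (X s))) = layerKernel (constA lam mu) (constB lam mu)
        (deriv (fun s => toComplex (X s)) s) (toComplex (φ (X s)))
        (toComplex x - toComplex (X s)) := fun s => by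
    rw [normal, toComplex_lineDeriv_kelvin lam mu (fun h0 => hx ⟨s, h0.symm⟩),
      deriv_toComplex_comp (hD.contDiff.differentiable two_ne_zero)]
  rw [h1]
  simp only [h2]
  have hper : Function.Periodic (fun s => layerKernel (constA lam mu) (constB lam mu)
      (deriv (fun s => toComplex (X s)) s) (toComplex (φ (X s)))
      (toComplex x - toComplex (X s))) (b - a) := fun s => by
    have := IsC2Curve.periodic_deriv_of (g := fun s => toComplex (X s)) (T := b - a)
      (fun r => by simp only [hD.periodic r]) s
    simp only [this, hD.periodic s]
  -- Periodicity moves the integration window from `[a, b]` to the period centred at `s₀`, later the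
  -- foot point.
  have h3 := hper.intervalIntegral_add_eq a (s₀ - (b - a) / 2)
  rw [add_sub_cancel, show s₀ - (b - a) / 2 + (b - a) = s₀ + (b - a) / 2 by ring] at h3
  exact h3

lemma IsC1Holder.contDiff {k : ℝ≥0} (hφ : IsC1Holder X k φ) :
    ContDiff ℝ 1 fun s => toComplex (φ (X s)) :=
  toComplex.contDiff.comp hφ.1

lemma toComplex_notMem_range {x : Plane} (hx : x ∉ range X) :
    toComplex x ∉ range fun s => toComplex (X s) := by
  rintro ⟨s, hs⟩
  exact hx ⟨s, toComplex.injective hs⟩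

/-- The derivative of the double layer potential off the boundary. -/
lemma IsC2Domain.hasFDerivAt_doubleLayerSharp (hD : IsC2Domain D a b X)
    (hφ : Continuous fun s => toComplex (φ (X s))) (s₀ : ℝ) {x : Plane} (hx : x ∉ range X) :
    HasFDerivAt (doubleLayerSharp lam mu a b X φ) (planeWirtinger
      (∫ s in (s₀ - (b - a) / 2)..(s₀ + (b - a) / 2), layerKernelDz (constA lam mu) (constB lam mu)
        (deriv (fun s => toComplex (X s)) s) (toComplex (φ (X s)))
        (toComplex x - toComplex (X s)))
      (∫ s in (s₀ - (b - a) / 2)..(s₀ + (b - a) / 2),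
        layerKernelDzbar (constA lam mu) (constB lam mu)
        (deriv (fun s => toComplex (X s)) s) (toComplex (φ (X s)))
        (toComplex x - toComplex (X s)))) x := by
  have h1 := hD.isC2Curve.hasFDerivAt_potential (constA lam mu) (constB lam mu) hφ s₀
    (toComplex_notMem_range hx)
  have h2 := (toComplex.symm.toContinuousLinearEquiv : ℂ →L[ℝ] Plane).hasFDerivAt.comp x
    (h1.comp x (toComplex.toContinuousLinearEquiv : Plane →L[ℝ] ℂ).hasFDerivAt)
  refine h2.congr_of_eventuallyEq ?_
  have hcl : IsClosed (range X) := hD.frontier_eq ▸ isClosed_frontier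
  filter_upwards [hcl.isOpen_compl.mem_nhds hx] with y hy
  exact hD.doubleLayerSharp_eq s₀ hy

lemma IsC2Domain.toComplex_normal (hD : IsC2Domain D a b X) (s : ℝ) :
    toComplex (normal X s) = -I * deriv (fun s => toComplex (X s)) s := by
  rw [normal, toComplex_rotNeg, deriv_toComplex_comp (hD.contDiff.differentiable two_ne_zero)]

lemma IsC2Domain.toComplex_conormal_eq (hD : IsC2Domain D a b X)
    (hφ : ContDiff ℝ 1 fun s => toComplex (φ (X s))) (s t : ℝ)
    (hx : X s + t • normal X s ∉ range X) :
    toComplex (conormal lam mu (doubleLayerSharp lam mu a b X φ) (normal X s)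
        (X s + t • normal X s))
      = tractionAlong lam mu (constA lam mu) (constB lam mu) ((b - a) / 2)
        (fun s => toComplex (X s)) (fun s => toComplex (φ (X s))) s t := by
  have hC := hD.isC2Curve
  have hper : Function.Periodic (fun s => toComplex (φ (X s))) (2 * ((b - a) / 2)) := fun r => by
    have h1 : r + 2 * ((b - a) / 2) = r + (b - a) := by ring
    simp only [h1, hD.periodic r]
  have hz := toComplex_notMem_range hx
  rw [toComplex_conormal lam mu (hD.hasFDerivAt_doubleLayerSharp hφ.continuous s hx),
    hC.integral_layerKernelDz _ _ hφ hper s hz, hC.integral_layerKernelDzbar _ _ hφ hper s hz]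
  have hxt : toComplex (X s + t • normal X s)
      = toComplex (X s) + t * (-I * deriv (fun s => toComplex (X s)) s) := by
    rw [map_add, map_smul, hD.toComplex_normal, Complex.real_smul]
  have i1 := IsC2Curve.integral_eq_layerAlong (L := (b - a) / 2) (Z := fun s => toComplex (X s))
    (fun w => w⁻¹) (deriv fun s => toComplex (φ (X s))) s t
  have i2 := IsC2Curve.integral_eq_layerAlong (L := (b - a) / 2) (Z := fun s => toComplex (X s))
    (fun w => (conj w)⁻¹) (deriv fun s => toComplex (φ (X s))) s t
  have i3 := IsC2Curve.integral_eq_layerAlong (L := (b - a) / 2) (Z := fun s => toComplex (X s))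
    (fun w => w / conj w ^ 2) (fun r => conj (deriv (fun s => toComplex (φ (X s))) r)) s t
  have i4 := IsC2Curve.integral_eq_layerAlong (L := (b - a) / 2) (Z := fun s => toComplex (X s))
    (fun w => (conj w)⁻¹) (twistedDeriv (fun s => toComplex (X s))
      fun s => toComplex (φ (X s))) s t
  rw [hxt, i1, i2, i3, i4, hD.toComplex_normal, tractionAlong]
  generalize layerAlong ((b - a) / 2) (fun s => toComplex (X s)) (fun w => w⁻¹)
    (deriv fun s => toComplex (φ (X s))) s t = F
  -- Only `Re ∂_z u` enters the traction, hence only the imaginary part of the Cauchy integral `F`.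
  have hre : ((constA lam mu / (4 * Real.pi) * I * F + constB lam mu / (4 * Real.pi) * I * conj F
      : ℂ).re : ℂ) = -((constA lam mu - constB lam mu) / (4 * Real.pi) * F.im) := by
    have e : (constA lam mu / (4 * Real.pi) * I * F + constB lam mu / (4 * Real.pi) * I * conj F
        : ℂ) = ((constA lam mu / (4 * Real.pi) : ℝ) : ℂ) * (I * F)
          + ((constB lam mu / (4 * Real.pi) : ℝ) : ℂ) * (I * conj F) := by
      push_cast
      ring
    rw [e, add_re, re_ofReal_mul, re_ofReal_mul]
    simp
    ring
  rw [hre]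
  ring

lemma IsC2Domain.toComplex_jumpDensity (hD : IsC2Domain D a b X)
    (hφ : ContDiff ℝ 1 fun s => toComplex (φ (X s))) (s : ℝ) :
    toComplex (jumpDensity lam mu X φ s)
      = -(I / 2) * ((1 - lam / (2 * mu + lam)) * deriv (fun s => toComplex (φ (X s))) s
        + (1 + lam / (2 * mu + lam)) * twistedDeriv (fun s => toComplex (X s))
          (fun s => toComplex (φ (X s))) s) := by
  have hC := hD.isC2Curve
  -- With `c = λ/(2μ+λ)`: `⟨φ,τ⟩ n = -(i/2)(f + f̄τ²)` and `c⟨φ,n⟩ τ = (i/2) c (f - f̄τ²)`.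
  have h1 : (fun r => ⟪φ (X r), tangent X r⟫ • normal X r
      + (lam / (2 * mu + lam) * ⟪φ (X r), normal X r⟫) • tangent X r)
      = fun r => toComplex.symm (-(I / 2) * ((1 - lam / (2 * mu + lam)) * toComplex (φ (X r))
        + (1 + lam / (2 * mu + lam)) *
          (conj (toComplex (φ (X r))) * deriv (fun s => toComplex (X s)) r ^ 2))) := by
    funext r
    rw [LinearIsometryEquiv.eq_symm_apply]
    have e1 := mul_conj_eq_one (hC.unit_speed r)
    have e2 : toComplex (tangent X r) = deriv (fun s => toComplex (X s)) r := by
      rw [tangent, deriv_toComplex_comp (hD.contDiff.differentiable two_ne_zero)]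
    simp only [map_add, map_smul, Complex.real_smul, inner_eq_re, ofReal_mul,
      Complex.re_eq_add_conj, hD.toComplex_normal, e2, map_mul, conj_conj, map_neg, conj_I]
    generalize deriv (fun s => toComplex (X s)) r = τ at *
    push_cast
    generalize conj τ = tc at *
    generalize toComplex (φ (X r)) = f
    generalize (lam / (2 * mu + lam) : ℂ) = c
    linear_combination (-(I / 2) * f + I * c / 2 * f) * e1
  have d1 := (hφ.differentiable one_ne_zero s).hasDerivAt
  have d2 := hC.hasDerivAt_twisted hφ s
  have d3 := ((d1.const_mul (1 - lam / (2 * mu + lam) : ℂ)).fun_add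
    (d2.const_mul (1 + lam / (2 * mu + lam) : ℂ))).const_mul (-(I / 2))
  have d4 := (toComplex.symm.toContinuousLinearEquiv : ℂ →L[ℝ] Plane).hasFDerivAt.comp_hasDerivAt
    s d3
  rw [jumpDensity, h1]
  have d5 : deriv _ s = _ := d4.deriv
  rw [← LinearIsometryEquiv.eq_symm_apply]
  exact d5

lemma isDiniAt_deriv_of_holderWith {L : ℝ} (hL : 0 < L) {g : ℝ → Plane} (hg : ContDiff ℝ 1 g)
    {C κ : ℝ≥0} (hκ : 0 < κ) (hh : HolderWith C κ (deriv g)) (s : ℝ) :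
    IsDiniAt L (deriv fun s => toComplex (g s)) s := by
  rw [deriv_toComplex_comp (hg.differentiable one_ne_zero)]
  refine IsDiniAt.of_holder hL ?_ (C := C) (κ := κ) (by exact_mod_cast hκ) fun σ _ => ?_
  · exact toComplex.continuous.comp (hg.continuous_deriv le_rfl)
  · rw [← map_sub, toComplex.norm_map, ← dist_eq_norm]
    refine (hh.dist_le _ _).trans (le_of_eq ?_)
    rw [Real.dist_eq, add_sub_cancel_left]

end Plane

lemma tendsto_of_toComplex {w : ℝ → Plane} {g : ℝ → ℂ} {F : Filter ℝ} {l : ℂ}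
    (hg : Tendsto g F (𝓝 l)) (he : ∀ᶠ t in F, toComplex (w t) = g t) :
    Tendsto w F (𝓝 (toComplex.symm l)) := by
  refine ((toComplex.symm.continuous.tendsto l).comp hg).congr' ?_
  filter_upwards [he] with t ht
  rw [Function.comp_apply, ← ht, LinearIsometryEquiv.symm_apply_apply]

end Elastic

theorem theorem4p4 (lam mu : ℝ) (hmu : 0 < mu) (hlam : 0 < lam + mu)
    (D : Set Elastic.Plane) (a b : ℝ) (X : ℝ → Elastic.Plane) (hD : Elastic.IsC2Domain D a b X)
    (k : ℝ≥0) (hk0 : 0 < k) (hk1 : k < 1)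
    (φ : Elastic.Plane → Elastic.Plane) (hφ : Elastic.IsC1Holder X k φ) :
    -- the potential is differentiable off the boundary, so that its conormal derivative makes sense
    DifferentiableOn ℝ (Elastic.doubleLayerSharp lam mu a b X φ) (frontier D)ᶜ ∧
    -- the jump relation at every boundary point
    (∀ s : ℝ, Tendsto
      (fun t : ℝ =>
        Elastic.conormal lam mu (Elastic.doubleLayerSharp lam mu a b X φ)
            (Elastic.normal X s) (X s + t • Elastic.normal X s)
          - Elastic.conormal lam mu (Elastic.doubleLayerSharp lam mu a b X φ)
            (Elastic.normal X s) (X s - t • Elastic.normal X s))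
      (𝓝[>] 0) (𝓝 (Elastic.jumpDensity lam mu X φ s))) ∧
    -- both one-sided conormal derivatives exist at almost every boundary point
    (∀ᵐ s : ℝ, ∃ Tp Tm : Elastic.Plane,
      Elastic.HasOuterTrace
        (Elastic.conormal lam mu (Elastic.doubleLayerSharp lam mu a b X φ) (Elastic.normal X s))
        (Elastic.normal X s) (X s) Tp ∧
      Elastic.HasInnerTrace
        (Elastic.conormal lam mu (Elastic.doubleLayerSharp lam mu a b X φ) (Elastic.normal X s))
        (Elastic.normal X s) (X s) Tm ∧
      Tp - Tm = Elastic.jumpDensity lam mu X φ s) ∧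
    -- they exist at every boundary point if the boundary has Hölder continuous curvature
    ((∃ α C : ℝ≥0, 0 < α ∧ HolderWith C α (deriv (deriv X))) →
      ∀ s : ℝ, ∃ Tp Tm : Elastic.Plane,
        Elastic.HasOuterTrace
          (Elastic.conormal lam mu (Elastic.doubleLayerSharp lam mu a b X φ) (Elastic.normal X s))
          (Elastic.normal X s) (X s) Tp ∧
        Elastic.HasInnerTrace
          (Elastic.conormal lam mu (Elastic.doubleLayerSharp lam mu a b X φ) (Elastic.normal X s))
          (Elastic.normal X s) (X s) Tm ∧
        Tp - Tm = Elastic.jumpDensity lam mu X φ s) := by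
  have hC := hD.isC2Curve
  have hf := hφ.contDiff
  obtain ⟨C₀, hC₀⟩ := hφ.2
  have hdini : ∀ s, Elastic.IsDiniAt ((b - a) / 2)
      (deriv fun s => Elastic.toComplex (φ (X s))) s := fun s =>
    Elastic.isDiniAt_deriv_of_holderWith hC.pos hφ.1 hk0 hC₀ s
  have hper : Function.Periodic (fun s => Elastic.toComplex (φ (X s))) (2 * ((b - a) / 2)) :=
    fun r => by
      have h1 : r + 2 * ((b - a) / 2) = r + (b - a) := by ring
      simp only [h1, hD.periodic r]
  have hev : ∀ s, ∀ᶠ t : ℝ in 𝓝[>] 0, X s + t • Elastic.normal X s ∉ range X ∧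
      X s + (-t) • Elastic.normal X s ∉ range X := fun s => by
    have hx : ∀ t : ℝ, X s + t • Elastic.normal X s ∈ range X →
        Elastic.toComplex (X s) + t * (-Complex.I * deriv (fun s => Elastic.toComplex (X s)) s)
          ∈ range fun s => Elastic.toComplex (X s) := by
      rintro t ⟨r, hr⟩
      refine ⟨r, ?_⟩
      simp only [hr, map_add, map_smul, hD.toComplex_normal, Complex.real_smul]
    filter_upwards [hC.eventually_normal_notMem_range s] with t ht
    exact ⟨fun h => ht.1 (hx t h), fun h => ht.2 (hx (-t) h)⟩
  have hjump : ∀ s : ℝ, Tendsto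
      (fun t : ℝ =>
        Elastic.conormal lam mu (Elastic.doubleLayerSharp lam mu a b X φ)
            (Elastic.normal X s) (X s + t • Elastic.normal X s)
          - Elastic.conormal lam mu (Elastic.doubleLayerSharp lam mu a b X φ)
            (Elastic.normal X s) (X s - t • Elastic.normal X s))
      (𝓝[>] 0) (𝓝 (Elastic.jumpDensity lam mu X φ s)) := fun s => by
    have h1 := hC.tendsto_tractionAlong_sub hmu hlam hf s
    rw [← hD.toComplex_jumpDensity hf s] at h1
    have h2 := Elastic.tendsto_of_toComplex h1 (w := fun t : ℝ =>
        Elastic.conormal lam mu (Elastic.doubleLayerSharp lam mu a b X φ)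
            (Elastic.normal X s) (X s + t • Elastic.normal X s)
          - Elastic.conormal lam mu (Elastic.doubleLayerSharp lam mu a b X φ)
            (Elastic.normal X s) (X s - t • Elastic.normal X s)) ?_
    · rwa [LinearIsometryEquiv.symm_apply_apply] at h2
    · filter_upwards [hev s] with t ht
      rw [sub_eq_add_neg (X s), ← neg_smul, map_sub, hD.toComplex_conormal_eq hf s t ht.1,
        hD.toComplex_conormal_eq hf s (-t) ht.2]
  have htraces : ∀ s : ℝ, (∃ l, Tendsto (Elastic.layerAlong ((b - a) / 2)
      (fun s => Elastic.toComplex (X s)) (fun w => (starRingEnd ℂ w)⁻¹)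
      (Elastic.twistedDeriv (fun s => Elastic.toComplex (X s))
        fun s => Elastic.toComplex (φ (X s))) s) (𝓝[>] 0) (𝓝 l)) →
      ∃ Tp Tm : Elastic.Plane,
        Elastic.HasOuterTrace
          (Elastic.conormal lam mu (Elastic.doubleLayerSharp lam mu a b X φ) (Elastic.normal X s))
          (Elastic.normal X s) (X s) Tp ∧
        Elastic.HasInnerTrace
          (Elastic.conormal lam mu (Elastic.doubleLayerSharp lam mu a b X φ) (Elastic.normal X s))
          (Elastic.normal X s) (X s) Tm ∧
        Tp - Tm = Elastic.jumpDensity lam mu X φ s := fun s hs => by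
    obtain ⟨l, hl⟩ := hC.exists_tendsto_tractionAlong lam mu (Elastic.constA lam mu)
      (Elastic.constB lam mu) hf (hdini s) hs
    have h1 : Tendsto (fun t : ℝ => Elastic.conormal lam mu
        (Elastic.doubleLayerSharp lam mu a b X φ) (Elastic.normal X s)
        (X s + t • Elastic.normal X s)) (𝓝[>] 0) (𝓝 (Elastic.toComplex.symm l)) := by
      refine Elastic.tendsto_of_toComplex hl ?_
      filter_upwards [hev s] with t ht using hD.toComplex_conormal_eq hf s t ht.1
    -- Only the outer limit was constructed; the inner one is the outer limit minus the jump, after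
    -- `t ↦ -t`.
    refine ⟨_, Elastic.toComplex.symm l - Elastic.jumpDensity lam mu X φ s, h1, ?_,
      sub_sub_cancel _ _⟩
    have h2 : Tendsto (fun t : ℝ => -t) (𝓝[<] 0) (𝓝[>] 0) := by
      have := tendsto_neg_nhdsLT (a := (0 : ℝ))
      rwa [neg_zero] at this
    refine ((h1.sub (hjump s)).comp h2).congr fun t => ?_
    simp only [Function.comp_apply, sub_sub_cancel, neg_smul, sub_neg_eq_add]
  refine ⟨?_, hjump, ?_, ?_⟩
  · intro x hx
    rw [hD.frontier_eq] at hx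
    exact (hD.hasFDerivAt_doubleLayerSharp hf.continuous 0 hx).differentiableAt.differentiableWithinAt
  · filter_upwards [hC.ae_exists_tendsto_layerAlong (hC.continuous_twistedDeriv hf)
      (hC.periodic_twistedDeriv hper)] with s hs using htraces s hs
  · rintro ⟨α, C, hα, hX⟩ s
    refine htraces s (hC.exists_tendsto_layerAlong Elastic.isOddKernel_conj_inv
      (hC.continuous_twistedDeriv hf) (hC.isDiniAt_twistedDeriv hf (hdini s) ?_))
    rw [Elastic.deriv_toComplex_comp (hD.contDiff.differentiable two_ne_zero)]
    exact Elastic.isDiniAt_deriv_of_holderWith hC.pos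
      (contDiff_succ_iff_deriv.1 hD.contDiff).2.2 hα hX s
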